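/- **Theorem.** Let $p$ be a prime, $N\ge 4$, $T=\{2,\dots,N-2\}$ and $D=N(N-3)/2$. Let $\mathbb{C}^D$ be the space of vectors $\boldsymbol{s}$ with coordinates $s_{1i}$, $s_{(N-1)i}$ ($i\in T$) and $s_{ij}$ ($2\le i<j\le N-2$). Put $$F(\boldsymbol{s},\boldsymbol{x})=\prod_{i=2}^{N-2}|x_i|_p^{s_{1i}}\,|1-x_i|_p^{s_{(N-1)i}}\prod_{2\le i<j\le N-2}|x_i-x_j|_p^{s_{ij}},\qquad Z^{(N)}(\boldsymbol{s})=\int_{\mathbb{Q}_p^{N-3}\smallsetminus\Lambda}F(\boldsymbol{s},\boldsymbol{x})\prod_{i=2}^{N-2}dx_i,$$ where $\Lambda=\{\boldsymbol{x}\in\mathbb{Q}_p^{N-3}:\ \prod_{i}x_i(1-x_i)\prod_{i<j}(x_i-x_j)=0\}$ and $dx_i$ is the Haar measure of $\mathbb{Q}_p$ with $\int_{\mathbb{Z}_p}dx=1$. Let $H(\mathbb{C})\subset\mathbb{C}^D$ be the set of all $\boldsymbol{s}$ such that * (C1) $|J|+\sum_{i\in J}\operatorname{Re}(s_{1i}+s_{(N-1)i})+\sum_{i<j,\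 i\in J}\operatorname{Re}(s_{ij})+\sum_{i<j,\ i\in T\smallsetminus J,\ j\in J}\operatorname{Re}(s_{ij})<0$ for all $\varnothing\ne J\subseteq T$; * (C2, C5) $|K|-1+\sum_{i<j,\ i,j\in K}\operatorname{Re}(s_{ij})>0$ for all $K\subseteq T$ with $|K|\ge2$; * (C4) $|J|+\sum_{i\in J}\operatorname{Re}(s_{ti})+\sum_{i<j,\ i,j\in J}\operatorname{Re}(s_{ij})>0$ for all $\varnothing\ne J\subseteq T$ and $t\in\{1,N-1\}$; * (C3, C6) $1+\operatorname{Re}(s)>0$ for every coordinate $s$ of $\boldsymbol{s}$, where $i,j$ run over $T$ in all the sums. (1) $H(\mathbb{C})$ is a non-empty open connected subset of $\mathbb{C}^D$; for $\boldsymbol{s}\in H(\mathbb{C})$ the integral $Z^{(N)}(\boldsymbol{s})$ converges absolutely, and it is a holomorphic function of $\boldsymbol{s}$ on $H(\mathbb{C})$. It has an analytic continuation to $\mathbb{C}^D$ as a rational function (with rational coefficients) of the variables $p^{-s}$, $s$ running over the coordinates of $\boldsymbol{s}$: there are polynomials $P,Q$ with rational coefficients such that $Q((p^{-s_{ij}}))\ne0$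 and $Z^{(N)}(\boldsymbol{s})=P((p^{-s_{ij}}))/Q((p^{-s_{ij}}))$ on $H(\mathbb{C})$. If $\boldsymbol{s}$ is a pole of this continuation (a point near which it does not extend holomorphically), then $\operatorname{Re}(\boldsymbol{s})\in\mathbb{R}^D$ lies on one of the finitely many hyperplanes obtained from (C1)–(C6) by replacing the signs $<$, $>$ by $=$. (2) If $\operatorname{Re}(s)\ge0$ for every coordinate $s$ of $\boldsymbol{s}\in\mathbb{C}^D$, then $\int_{\mathbb{Q}_p^{N-3}\smallsetminus\Lambda}|F(\boldsymbol{s},\boldsymbol{x})|\prod_i dx_i=+\infty$; in particular, for real $\boldsymbol{s}$ with non-negative coordinates the integral $Z^{(N)}(\boldsymbol{s})$ diverges to $+\infty$. -/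

import Mathlib

open MeasureTheory Topology Filter

/-! ## Haar measure on `ℚ_p` and on `ℚ_p^{N-3}` -/

/-- `ℚ_p` with its Borel `σ`-algebra. -/
noncomputable instance padicMeasurableSpace (p : ℕ) [Fact p.Prime] : MeasurableSpace ℚ_[p] := borel _

instance padicBorelSpace (p : ℕ) [Fact p.Prime] : BorelSpace ℚ_[p] := ⟨rfl⟩

/-- The unit ball `ℤ_p = {x : |x|_p ≤ 1}`, as a compact set with non-empty interior. -/
noncomputable def padicUnitBall (p : ℕ) [Fact p.Prime] : TopologicalSpace.PositiveCompacts ℚ_[p] where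
  carrier := Metric.closedBall 0 1
  isCompact' := isCompact_closedBall 0 1
  interior_nonempty' :=
    ⟨0, Metric.ball_subset_interior_closedBall (Metric.mem_ball_self one_pos)⟩

/-- The Haar measure of `(ℚ_p, +)`, normalized by giving `ℤ_p` measure `1`. -/
noncomputable def padicHaar (p : ℕ) [Fact p.Prime] : Measure ℚ_[p] :=
  Measure.addHaarMeasure (padicUnitBall p)

namespace StringZeta

/-- `T = {2, …, N-2}`. -/
abbrev T (N : ℕ) : Type := {i : ℕ // i ∈ Finset.Icc 2 (N - 2)}

/-- The pairs `(i, j)` with `2 ≤ i < j ≤ N-2`. -/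
abbrev Pair (N : ℕ) : Type := {e : T N × T N // e.1 < e.2}

/-- The index set of the variables: `s_{1i}` (`i ∈ T`), `s_{(N-1)i}` (`i ∈ T`), and
`s_{ij}` (`2 ≤ i < j ≤ N-2`). It has `D = N(N-3)/2` elements, so that `Var N → ℂ` is `ℂ^D`. -/
abbrev Var (N : ℕ) : Type := T N ⊕ T N ⊕ Pair N

/-- The index of `s_{1i}`. -/
abbrev Var.first {N : ℕ} (i : T N) : Var N := Sum.inl i

/-- The index of `s_{(N-1)i}`. -/
abbrev Var.last {N : ℕ} (i : T N) : Var N := Sum.inr (Sum.inl i)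

/-- The index of `s_{ij}`, `2 ≤ i < j ≤ N-2`. -/
abbrev Var.pair {N : ℕ} (e : Pair N) : Var N := Sum.inr (Sum.inr e)

/-- The product of the normalized Haar measures on `ℚ_p^{N-3}`. -/
noncomputable def haar (p : ℕ) [Fact p.Prime] (N : ℕ) : Measure (T N → ℚ_[p]) :=
  Measure.pi fun _ => padicHaar p

/-- The divisor `Λ`. -/
def divisor (p : ℕ) [Fact p.Prime] (N : ℕ) : Set (T N → ℚ_[p]) :=
  {x | (∏ i : T N, x i * (1 - x i)) * ∏ e : Pair N, (x e.1.1 - x e.1.2) = 0}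

/-- The integrand
`F(s, x) = ∏ᵢ |xᵢ|^{s_{1i}} |1 - xᵢ|^{s_{(N-1)i}} ∏_{i<j} |xᵢ - xⱼ|^{s_{ij}}`. -/
noncomputable def integrand (p : ℕ) [Fact p.Prime] (N : ℕ) (s : Var N → ℂ)
    (x : T N → ℚ_[p]) : ℂ :=
  (∏ i : T N, ((‖x i‖ : ℝ) : ℂ) ^ s (Var.first i) * ((‖1 - x i‖ : ℝ) : ℂ) ^ s (Var.last i)) *
    ∏ e : Pair N, ((‖x e.1.1 - x e.1.2‖ : ℝ) : ℂ) ^ s (Var.pair e)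

/-- The integral `Z^{(N)}(s)` over `ℚ_p^{N-3} ∖ Λ`. -/
noncomputable def zeta (p : ℕ) [Fact p.Prime] (N : ℕ) (s : Var N → ℂ) : ℂ :=
  ∫ x in (divisor p N)ᶜ, integrand p N s x ∂(haar p N)

/-! ## The linear conditions

Below `σ` stands for the vector of the real parts `Re(s_{ij})`. -/

/-- C1: `|J| + ∑_{i∈J} (σ_{1i} + σ_{(N-1)i}) + ∑_{i<j, i∈J} σ_{ij} + ∑_{i<j, i∉J, j∈J} σ_{ij}`. -/
noncomputable def formC1 {N : ℕ} (J : Finset (T N)) (σ : Var N → ℝ) : ℝ :=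
  (J.card : ℝ) + ∑ i ∈ J, (σ (Var.first i) + σ (Var.last i))
    + ∑ e : Pair N with e.1.1 ∈ J, σ (Var.pair e)
    + ∑ e : Pair N with e.1.1 ∉ J ∧ e.1.2 ∈ J, σ (Var.pair e)

/-- C2 and C5: `|K| - 1 + ∑_{i<j, i,j∈K} σ_{ij}`. -/
noncomputable def formC2 {N : ℕ} (K : Finset (T N)) (σ : Var N → ℝ) : ℝ :=
  (K.card : ℝ) - 1 + ∑ e : Pair N with e.1.1 ∈ K ∧ e.1.2 ∈ K, σ (Var.pair e)

/-- C4 for `t = 1`: `|J| + ∑_{i∈J} σ_{1i} + ∑_{i<j, i,j∈J} σ_{ij}`. -/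
noncomputable def formC4First {N : ℕ} (J : Finset (T N)) (σ : Var N → ℝ) : ℝ :=
  (J.card : ℝ) + ∑ i ∈ J, σ (Var.first i)
    + ∑ e : Pair N with e.1.1 ∈ J ∧ e.1.2 ∈ J, σ (Var.pair e)

/-- C4 for `t = N-1`: `|J| + ∑_{i∈J} σ_{(N-1)i} + ∑_{i<j, i,j∈J} σ_{ij}`. -/
noncomputable def formC4Last {N : ℕ} (J : Finset (T N)) (σ : Var N → ℝ) : ℝ :=
  (J.card : ℝ) + ∑ i ∈ J, σ (Var.last i)
    + ∑ e : Pair N with e.1.1 ∈ J ∧ e.1.2 ∈ J, σ (Var.pair e)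

/-- C3 and C6: `1 + σ_{ij}`. -/
noncomputable def formC6 {N : ℕ} (v : Var N) (σ : Var N → ℝ) : ℝ := 1 + σ v

/-- The vector of real parts of `s`. -/
def rePart {N : ℕ} (s : Var N → ℂ) : Var N → ℝ := fun v => (s v).re

/-- `H(ℂ)`: the solution set of the conditions C1-C6. -/
def H (N : ℕ) : Set (Var N → ℂ) :=
  {s | (∀ J : Finset (T N), J.Nonempty → formC1 J (rePart s) < 0) ∧
    (∀ K : Finset (T N), 2 ≤ K.card → 0 < formC2 K (rePart s)) ∧
    (∀ J : Finset (T N), J.Nonempty → 0 < formC4First J (rePart s)) ∧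
    (∀ J : Finset (T N), J.Nonempty → 0 < formC4Last J (rePart s)) ∧
    (∀ v : Var N, 0 < formC6 v (rePart s))}

/-- The union of the hyperplanes of `ℝ^D` obtained from C1-C6 by replacing the inequality signs
by equality signs (a finite union, since every index set is finite). -/
def hyperplanes (N : ℕ) : Set (Var N → ℝ) :=
  (⋃ (J : Finset (T N)) (_ : J.Nonempty), {σ | formC1 J σ = 0}) ∪
  (⋃ (K : Finset (T N)) (_ : 2 ≤ K.card), {σ | formC2 K σ = 0}) ∪
  (⋃ (J : Finset (T N)) (_ : J.Nonempty), {σ | formC4First J σ = 0}) ∪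
  (⋃ (J : Finset (T N)) (_ : J.Nonempty), {σ | formC4Last J σ = 0}) ∪
  (⋃ v : Var N, {σ | formC6 v σ = 0})

/-! ## Rational functions of the variables `p^{-s_{ij}}` -/

/-- The value of the polynomial `P` at the point `(p^{-s_{ij}})`. -/
noncomputable def evalPow (p : ℕ) {N : ℕ} (P : MvPolynomial (Var N) ℚ) (s : Var N → ℂ) : ℂ :=
  MvPolynomial.aeval (fun v => (p : ℂ) ^ (-s v)) P

/-- `s₀` is a pole of `s ↦ P(p^{-s}) / Q(p^{-s})`: this function, which is holomorphic where the
denominator does not vanish, does not extend holomorphically to a neighbourhood of `s₀`. -/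
def IsPole (p : ℕ) {N : ℕ} (P Q : MvPolynomial (Var N) ℚ) (s₀ : Var N → ℂ) : Prop :=
  ¬ ∃ g : (Var N → ℂ) → ℂ, AnalyticAt ℂ g s₀ ∧
    ∀ᶠ s in 𝓝 s₀, evalPow p Q s ≠ 0 → g s = evalPow p P s / evalPow p Q s

end StringZeta

open scoped ENNReal Pointwise

/-!
At a real point `σ` the absolute value of the integrand is a product of powers of the factors. Cover
`ℙ¹(ℚ_p)` by the residue discs of the points of `ℙ¹(𝔽_p)`, each parametrized by `ℤ_p`. In terms of
chordal distances the point `∞` plays the same role as `0` and `1`, and points of different discs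
have distance `1`, so the integral is a finite sum of products, over the discs, of means of products
`∏ |x_i - x_j|^τ` over independent points of `ℤ_p`, where the mark `0`, `1` or `∞` that lies in the
disc, if any, is one more point, fixed at `0`.

Such a mean is a sum over the largest `k` for which all points of the block are congruent modulo
`p ^ k`. Dilation by `p` makes this sum a geometric series of ratio `p^(-f(σ))`, where `f` is one of
the affine forms of C1-C6, and its first term only involves smaller blocks. By induction the
integral converges on the region `H`, as a rational function of the `p^(-σ)` whose denominator
`∏ (1 - p^(-f(σ)))` vanishes only over the hyperplanes. On a complex line through a real point in a
real direction the zeta integral is the complex moment generating function of the logarithm of the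
integrand, so the identity theorem extends the formula from real to complex points of `H`.

When all exponents are non-negative, the integrand is at least `1` in absolute value on a box of
infinite measure, where the coordinates have distinct absolute values, all greater than `1`.
-/

namespace StringZeta

attribute [local fun_prop] measurable_inv

/-! ## Powers of the absolute value and the Haar measure of `ℚ_p` -/

section NormPow

variable {𝕜 : Type*} [NormedField 𝕜]

open Classical in
/-- The function `|x|^t` on a normed field, with values in `[0, ∞)`. It vanishes at `0` for every
exponent, which makes it finite and multiplicative in `x`, and additive in `t`. -/
noncomputable def normPow (t : ℝ) (x : 𝕜) : ℝ≥0∞ := if x = 0 then 0 else ‖x‖ₑ ^ t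

@[simp] lemma normPow_zero_right (t : ℝ) : normPow t (0 : 𝕜) = 0 := if_pos rfl

lemma normPow_of_ne {x : 𝕜} (hx : x ≠ 0) (t : ℝ) : normPow t x = ‖x‖ₑ ^ t := if_neg hx

lemma normPow_congr {x y : 𝕜} (h : ‖x‖ = ‖y‖) (t : ℝ) : normPow t x = normPow t y := by
  have h0 : x = 0 ↔ y = 0 := by rw [← norm_eq_zero, h, norm_eq_zero]
  classical
  simp only [normPow, ← ofReal_norm, h]
  exact if_congr h0 rfl rfl

lemma normPow_eq_one {x : 𝕜} (hx : ‖x‖ = 1) (t : ℝ) : normPow t x = 1 := by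
  rw [normPow_congr (hx.trans norm_one.symm), normPow_of_ne one_ne_zero, enorm_one,
    ENNReal.one_rpow]

lemma normPow_neg (t : ℝ) (x : 𝕜) : normPow t (-x) = normPow t x := normPow_congr (norm_neg x) t

lemma normPow_sub_comm (t : ℝ) (x y : 𝕜) : normPow t (x - y) = normPow t (y - x) :=
  normPow_congr (norm_sub_rev x y) t

lemma normPow_ne_top (t : ℝ) (x : 𝕜) : normPow t x ≠ ⊤ := by
  rcases eq_or_ne x 0 with rfl | hx
  · simp
  · rw [normPow_of_ne hx]
    exact ENNReal.rpow_ne_top_of_ne_zero (enorm_ne_zero.2 hx) enorm_ne_top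

lemma toReal_normPow {x : 𝕜} (hx : x ≠ 0) (t : ℝ) : (normPow t x).toReal = ‖x‖ ^ t := by
  rw [normPow_of_ne hx, ← ENNReal.toReal_rpow, toReal_enorm]

lemma one_le_normPow {t : ℝ} (ht : 0 ≤ t) {x : 𝕜} (hx : 1 ≤ ‖x‖) : 1 ≤ normPow t x := by
  have hx0 : x ≠ 0 := norm_pos_iff.1 (zero_lt_one.trans_le hx)
  rw [← ENNReal.ofReal_one, ENNReal.ofReal_le_iff_le_toReal (normPow_ne_top t x),
    toReal_normPow hx0]
  exact Real.one_le_rpow hx ht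

lemma normPow_mul (t : ℝ) (x y : 𝕜) : normPow t (x * y) = normPow t x * normPow t y := by
  rcases eq_or_ne x 0 with rfl | hx
  · simp
  rcases eq_or_ne y 0 with rfl | hy
  · simp
  rw [normPow_of_ne hx, normPow_of_ne hy, normPow_of_ne (mul_ne_zero hx hy), enorm_mul,
    ENNReal.mul_rpow_of_ne_top enorm_ne_top enorm_ne_top]

lemma normPow_add (s t : ℝ) (x : 𝕜) : normPow (s + t) x = normPow s x * normPow t x := by
  rcases eq_or_ne x 0 with rfl | hx
  · simp
  · rw [normPow_of_ne hx, normPow_of_ne hx, normPow_of_ne hx,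
      ENNReal.rpow_add _ _ (enorm_ne_zero.2 hx) enorm_ne_top]

lemma normPow_inv (t : ℝ) (x : 𝕜) : normPow t x⁻¹ = normPow (-t) x := by
  rcases eq_or_ne x 0 with rfl | hx
  · simp
  · rw [normPow_of_ne hx, normPow_of_ne (inv_ne_zero hx), enorm_inv hx, ENNReal.inv_rpow,
      ENNReal.rpow_neg]

@[fun_prop]
lemma measurable_normPow [MeasurableSpace 𝕜] [OpensMeasurableSpace 𝕜] (t : ℝ) :
    Measurable (normPow t : 𝕜 → ℝ≥0∞) := by
  classical
  exact Measurable.ite (measurableSet_singleton 0) measurable_const (measurable_enorm.pow_const t)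

end NormPow

section GroupWithZero

variable {K : Type*} [CommGroupWithZero K] [MeasurableSpace K] [MeasurableMul₂ K]
  {μ : Measure K}

lemma lintegral_mul_left_of_map_mul_left (hμ : ∀ u ≠ 0, μ.map (u * ·) = μ) {h : K → ℝ≥0∞}
    (hh : Measurable h) {u : K} (hu : u ≠ 0) : ∫⁻ x, h (u * x) ∂μ = ∫⁻ x, h x ∂μ := by
  rw [← lintegral_map hh (measurable_const_mul u), hμ u hu]

/-- Both sides times `∫ φ` are the integral of `h y * φ x` after shears of the plane that preserve
`μ.prod μ`. -/
lemma lintegral_inv_of_map_mul_left [MeasurableInv K] [SFinite μ] (h0 : ∀ᵐ x ∂μ, x ≠ 0)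
    (hμ : ∀ u ≠ 0, μ.map (u * ·) = μ)
    {φ : K → ℝ≥0∞} (hφ : Measurable φ) (hφ0 : ∫⁻ x, φ x ∂μ ≠ 0) (hφt : ∫⁻ x, φ x ∂μ ≠ ⊤)
    {h : K → ℝ≥0∞} (hh : Measurable h) : ∫⁻ x, h x⁻¹ ∂μ = ∫⁻ x, h x ∂μ := by
  refine (ENNReal.mul_left_inj hφ0 hφt).1 ?_
  calc (∫⁻ x, h x⁻¹ ∂μ) * ∫⁻ x, φ x ∂μ
      = ∫⁻ x, ∫⁻ y, h x⁻¹ * φ y ∂μ ∂μ := (lintegral_lintegral_mul (by fun_prop) (by fun_prop)).symm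
    _ = ∫⁻ x, ∫⁻ y, h x⁻¹ * φ (x * y) ∂μ ∂μ := by
        refine lintegral_congr_ae (h0.mono fun x hx => ?_)
        exact (lintegral_mul_left_of_map_mul_left hμ (h := fun y => h x⁻¹ * φ y) (by fun_prop)
          hx).symm
    _ = ∫⁻ y, ∫⁻ x, h x⁻¹ * φ (x * y) ∂μ ∂μ := lintegral_lintegral_swap (by fun_prop)
    _ = ∫⁻ y, ∫⁻ x, h (y * x⁻¹) * φ x ∂μ ∂μ := by
        refine lintegral_congr_ae (h0.mono fun y hy => ?_)
        beta_reduce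
        rw [← lintegral_mul_left_of_map_mul_left hμ (h := fun x => h (y * x⁻¹) * φ x)
          (by fun_prop) hy]
        exact lintegral_congr fun x => by rw [mul_comm x y, mul_inv, mul_inv_cancel_left₀ hy]
    _ = ∫⁻ x, ∫⁻ y, h (y * x⁻¹) * φ x ∂μ ∂μ := lintegral_lintegral_swap (by fun_prop)
    _ = ∫⁻ x, ∫⁻ y, h y * φ x ∂μ ∂μ := by
        refine lintegral_congr_ae (h0.mono fun x hx => ?_)
        beta_reduce
        rw [← lintegral_mul_left_of_map_mul_left hμ (h := fun y => h y * φ x) (by fun_prop)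
          (inv_ne_zero hx)]
        exact lintegral_congr fun y => by rw [mul_comm y]
    _ = ∫⁻ y, ∫⁻ x, h y * φ x ∂μ ∂μ := lintegral_lintegral_swap (by fun_prop)
    _ = (∫⁻ x, h x ∂μ) * ∫⁻ x, φ x ∂μ := lintegral_lintegral_mul (by fun_prop) (by fun_prop)

end GroupWithZero

section PadicHaar

variable (p : ℕ) [hp : Fact p.Prime]

instance : (padicHaar p).IsAddHaarMeasure := by
  unfold padicHaar; infer_instance

lemma padicHaar_closedBall_one : padicHaar p (Metric.closedBall 0 1) = 1 :=
  Measure.addHaarMeasure_self (K₀ := padicUnitBall p)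

lemma natCast_ennreal_ne_zero : (p : ℝ≥0∞) ≠ 0 := Nat.cast_ne_zero.2 hp.1.ne_zero

lemma natCast_padic_ne_zero : (p : ℚ_[p]) ≠ 0 := Nat.cast_ne_zero.2 hp.1.ne_zero

variable {p}

lemma enorm_natCast_prime : ‖(p : ℚ_[p])‖ₑ = (p : ℝ≥0∞)⁻¹ := by
  rw [← ofReal_norm, Padic.norm_p, ENNReal.ofReal_inv_of_pos (Nat.cast_pos.2 hp.1.pos),
    ENNReal.ofReal_natCast]

lemma normPow_natCast_prime (t : ℝ) : normPow t (p : ℚ_[p]) = (p : ℝ≥0∞) ^ (-t) := by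
  rw [normPow_of_ne (natCast_padic_ne_zero p), enorm_natCast_prime, ENNReal.inv_rpow,
    ENNReal.rpow_neg]

lemma norm_p_mul_lt_one_iff {x : ℚ_[p]} : ‖(p : ℚ_[p]) * x‖ < 1 ↔ ‖x‖ ≤ 1 := by
  have h := Padic.norm_le_pow_iff_norm_lt_pow_add_one x 0
  rw [zpow_zero, zero_add, zpow_one] at h
  rw [h, norm_mul, Padic.norm_p, inv_mul_lt_one₀ (Nat.cast_pos.2 hp.1.pos)]

lemma norm_sub_le_one {x y : ℚ_[p]} (hx : ‖x‖ ≤ 1) (hy : ‖y‖ ≤ 1) : ‖x - y‖ ≤ 1 := by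
  rw [sub_eq_add_neg]
  exact (Padic.nonarchimedean x (-y)).trans (max_le hx (by rwa [norm_neg]))

lemma norm_natCast_le_one (a : ℕ) : ‖(a : ℚ_[p])‖ ≤ 1 := by
  simpa using Padic.norm_int_le_one (p := p) (a : ℤ)

lemma existsUnique_mem_ball_natCast {x : ℚ_[p]} (hx : ‖x‖ ≤ 1) :
    ∃! a : Fin p, x ∈ Metric.ball ((a : ℕ) : ℚ_[p]) 1 := by
  obtain ⟨x, rfl⟩ : ∃ z : ℤ_[p], (z : ℚ_[p]) = x := ⟨⟨x, hx⟩, rfl⟩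
  obtain ⟨n, ⟨hn, hn'⟩, huniq⟩ := PadicInt.existsUnique_mem_range x
  have mem_ball_iff (m : ℕ) : (x : ℚ_[p]) ∈ Metric.ball (m : ℚ_[p]) 1 ↔
      x - (m : ℤ_[p]) ∈ IsLocalRing.maximalIdeal ℤ_[p] := by
    rw [IsLocalRing.mem_maximalIdeal, PadicInt.mem_nonunits, PadicInt.norm_def,
      PadicInt.coe_sub, PadicInt.coe_natCast, mem_ball_iff_norm]
  exact ⟨⟨n, hn⟩, (mem_ball_iff n).2 hn',
    fun b hb => Fin.ext (huniq b ⟨b.2, (mem_ball_iff b).1 hb⟩)⟩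

lemma closedBall_eq_iUnion_ball_natCast :
    Metric.closedBall (0 : ℚ_[p]) 1 = ⋃ a : Fin p, Metric.ball ((a : ℕ) : ℚ_[p]) 1 := by
  refine subset_antisymm (fun x hx => ?_) (Set.iUnion_subset fun a => ?_)
  · exact Set.mem_iUnion.2 (existsUnique_mem_ball_natCast (mem_closedBall_zero_iff.1 hx)).exists
  · have ha : ((a : ℕ) : ℚ_[p]) ∈ Metric.closedBall 0 1 :=
      mem_closedBall_zero_iff.2 (norm_natCast_le_one (p := p) a)
    rw [IsUltrametricDist.closedBall_eq_of_mem ha]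
    exact Metric.ball_subset_closedBall

lemma pairwise_disjoint_ball_natCast : Pairwise (Function.onFun Disjoint
    fun a : Fin p => Metric.ball ((a : ℕ) : ℚ_[p]) 1) := by
  intro a b hab
  refine Set.disjoint_left.2 fun x hx hx' => hab ?_
  have hx1 : x ∈ Metric.closedBall (0 : ℚ_[p]) 1 := by
    rw [closedBall_eq_iUnion_ball_natCast]
    exact Set.mem_iUnion.2 ⟨a, hx⟩
  exact (existsUnique_mem_ball_natCast (mem_closedBall_zero_iff.1 hx1)).unique hx hx'

lemma norm_natCast_sub_natCast {a b : Fin p} (h : a ≠ b) :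
    ‖((a : ℕ) : ℚ_[p]) - ((b : ℕ) : ℚ_[p])‖ = 1 := by
  refine le_antisymm ?_ (not_lt.1 fun hlt => h ?_)
  · simpa using Padic.norm_int_le_one (p := p) ((a : ℕ) - (b : ℕ) : ℤ)
  · exact (existsUnique_mem_ball_natCast (norm_natCast_le_one (p := p) a)).unique
      (Metric.mem_ball_self one_pos) (mem_ball_iff_norm.2 hlt)

lemma padicHaar_ball_one (a : ℚ_[p]) : padicHaar p (Metric.ball a 1) = (p : ℝ≥0∞)⁻¹ := by
  have translate (b : ℚ_[p]) : padicHaar p (Metric.ball b 1) = padicHaar p (Metric.ball a 1) := by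
    rw [← measure_preimage_add_right (padicHaar p) (b - a)]
    congr 1
    ext x
    rw [Set.mem_preimage, mem_ball_iff_norm, mem_ball_iff_norm, ← add_sub_assoc, add_sub_right_comm,
      add_sub_cancel_right]
  have h := padicHaar_closedBall_one p
  rw [closedBall_eq_iUnion_ball_natCast, measure_iUnion pairwise_disjoint_ball_natCast
    fun _ => Metric.isOpen_ball.measurableSet, tsum_fintype] at h
  simp only [translate, Finset.sum_const, Finset.card_univ, Fintype.card_fin, nsmul_eq_mul] at h
  exact ENNReal.eq_inv_of_mul_eq_one_left (by rwa [mul_comm])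

lemma smul_closedBall_one (u : ℚ_[p]ˣ) :
    u • Metric.closedBall (0 : ℚ_[p]) 1 = Metric.closedBall 0 ‖(u : ℚ_[p])‖ := by
  rw [Units.smul_def, smul_closedBall _ _ zero_le_one]
  simp

lemma distribHaarChar_padic (u : ℚ_[p]ˣ) : distribHaarChar ℚ_[p] u = ‖(u : ℚ_[p])‖₊ := by
  let ball : Set ℚ_[p] := Metric.closedBall 0 1
  have ball_one : padicHaar p ball = 1 := padicHaar_closedBall_one p
  have of_smul {w : ℚ_[p]ˣ} {r : NNReal} (hw : padicHaar p (w • ball) = r) :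
      distribHaarChar ℚ_[p] w = r :=
    distribHaarChar_eq_of_measure_smul_eq_mul (μ := padicHaar p) (s := ball)
      (by simp [ball_one]) (by simp [ball_one]) (by rw [hw, ball_one, mul_one])
  let π : ℚ_[p]ˣ := Units.mk0 p (natCast_padic_ne_zero p)
  have char_prime : distribHaarChar ℚ_[p] π = ‖(p : ℚ_[p])‖₊ := by
    refine of_smul ?_
    have : π • ball = Metric.ball 0 1 := by
      rw [smul_closedBall_one]
      ext x
      rw [mem_closedBall_zero_iff, mem_ball_zero_iff, Units.val_mk0, Padic.norm_p,
        ← zpow_neg_one, Padic.norm_le_pow_iff_norm_lt_pow_add_one]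
      simp
    rw [this, padicHaar_ball_one, ← enorm_natCast_prime, enorm_eq_nnnorm]
  have char_unit {w : ℚ_[p]ˣ} (hw : ‖(w : ℚ_[p])‖ = 1) : distribHaarChar ℚ_[p] w = 1 :=
    of_smul (by rw [smul_closedBall_one, hw, padicHaar_closedBall_one, ENNReal.coe_one])
  obtain ⟨k, hk⟩ : ∃ k : ℤ, ‖(u : ℚ_[p])‖ = ‖(p : ℚ_[p])‖ ^ k :=
    ⟨_, by rw [Padic.norm_p, inv_zpow', Padic.norm_eq_zpow_neg_valuation u.ne_zero]⟩
  have hw : ‖((u / π ^ k : ℚ_[p]ˣ) : ℚ_[p])‖ = 1 := by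
    simp [π, Units.val_div_eq_div_val, hk, hp.1.ne_zero, zpow_ne_zero]
  rw [← div_mul_cancel u (π ^ k), map_mul, map_zpow, char_unit hw, char_prime, one_mul]
  ext
  simp [hk]

lemma map_mul_left_padicHaar {u : ℚ_[p]} (hu : u ≠ 0) :
    (padicHaar p).map (u * ·) = ‖u‖ₑ⁻¹ • padicHaar p := by
  ext s hs
  let w : ℚ_[p]ˣ := Units.mk0 u hu
  have h := distribHaarChar_mul (padicHaar p) w⁻¹ s
  rw [distribHaarChar_padic, ← Set.preimage_smul, Units.val_inv_eq_inv_val, Units.val_mk0] at h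
  rw [Measure.map_apply (measurable_const_mul u) hs, Measure.smul_apply, smul_eq_mul,
    ← enorm_inv hu]
  exact h.symm

lemma lintegral_mul_left_padicHaar {u : ℚ_[p]} (hu : u ≠ 0) {h : ℚ_[p] → ℝ≥0∞}
    (hh : Measurable h) :
    ∫⁻ x, h (u * x) ∂padicHaar p = ‖u‖ₑ⁻¹ * ∫⁻ x, h x ∂padicHaar p := by
  rw [← lintegral_map hh (measurable_const_mul u), map_mul_left_padicHaar hu,
    lintegral_smul_measure, smul_eq_mul]

/-- The measure `dx / |x|` on `ℚ_p`, the Haar measure of the multiplicative group. -/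
noncomputable def mulPadicHaar (p : ℕ) [Fact p.Prime] : Measure ℚ_[p] :=
  (padicHaar p).withDensity (normPow (-1))

lemma lintegral_mulPadicHaar {h : ℚ_[p] → ℝ≥0∞} (hh : Measurable h) :
    ∫⁻ x, h x ∂mulPadicHaar p = ∫⁻ x, normPow (-1) x * h x ∂padicHaar p :=
  lintegral_withDensity_eq_lintegral_mul _ (measurable_normPow _) hh

lemma ae_mulPadicHaar_ne_zero : ∀ᵐ x ∂mulPadicHaar p, x ≠ 0 := by
  rw [mulPadicHaar, ae_withDensity_iff (measurable_normPow _)]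
  exact Eventually.of_forall fun x hx hx0 => hx (by rw [hx0, normPow_zero_right])

lemma map_mul_left_mulPadicHaar {u : ℚ_[p]} (hu : u ≠ 0) :
    (mulPadicHaar p).map (u * ·) = mulPadicHaar p := by
  refine Measure.ext_of_lintegral _ fun h hh => ?_
  have density (x : ℚ_[p]) : normPow (-1) x = ‖u‖ₑ * normPow (-1) (u * x) := by
    rw [normPow_mul, normPow_of_ne hu, ENNReal.rpow_neg_one, ← mul_assoc,
      ENNReal.mul_inv_cancel (enorm_ne_zero.2 hu) enorm_ne_top, one_mul]
  rw [lintegral_map hh (measurable_const_mul u), lintegral_mulPadicHaar (by fun_prop),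
    lintegral_mulPadicHaar hh]
  calc ∫⁻ x, normPow (-1) x * h (u * x) ∂padicHaar p
      = ‖u‖ₑ * ∫⁻ x, normPow (-1) (u * x) * h (u * x) ∂padicHaar p := by
        rw [← lintegral_const_mul _ (by fun_prop)]
        exact lintegral_congr fun x => by rw [density, mul_assoc]
    _ = ∫⁻ x, normPow (-1) x * h x ∂padicHaar p := by
        rw [lintegral_mul_left_padicHaar hu (h := fun x => normPow (-1) x * h x) (by fun_prop),
          ← mul_assoc, ENNReal.mul_inv_cancel (enorm_ne_zero.2 hu) enorm_ne_top, one_mul]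

lemma mulPadicHaar_ball_one_one : mulPadicHaar p (Metric.ball 1 1) = (p : ℝ≥0∞)⁻¹ := by
  rw [mulPadicHaar, withDensity_apply _ Metric.isOpen_ball.measurableSet, ← padicHaar_ball_one 1,
    ← setLIntegral_one]
  refine setLIntegral_congr_fun Metric.isOpen_ball.measurableSet fun x hx => normPow_eq_one ?_ _
  have := Padic.norm_eq_of_norm_add_lt_right (p := p) (z1 := x) (z2 := -1)
    (by simpa [← sub_eq_add_neg] using mem_ball_iff_norm.1 hx)
  simpa using this

lemma lintegral_inv_mulPadicHaar {h : ℚ_[p] → ℝ≥0∞} (hh : Measurable h) :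
    ∫⁻ x, h x⁻¹ ∂mulPadicHaar p = ∫⁻ x, h x ∂mulPadicHaar p := by
  have : SFinite (mulPadicHaar p) := by unfold mulPadicHaar; infer_instance
  have hφ : ∫⁻ x, (Metric.ball 1 1).indicator 1 x ∂mulPadicHaar p = (p : ℝ≥0∞)⁻¹ := by
    rw [lintegral_indicator_one Metric.isOpen_ball.measurableSet, mulPadicHaar_ball_one_one]
  refine lintegral_inv_of_map_mul_left ae_mulPadicHaar_ne_zero
    (fun u hu => map_mul_left_mulPadicHaar hu)
    (measurable_one.indicator (Metric.isOpen_ball (x := 1) (ε := 1)).measurableSet) ?_ ?_ hh <;>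
  simp [hφ, hp.1.ne_zero]

lemma lintegral_inv_padicHaar {h : ℚ_[p] → ℝ≥0∞} (hh : Measurable h) (h0 : h 0 = 0) :
    ∫⁻ x, h x⁻¹ * normPow (-2) x ∂padicHaar p = ∫⁻ x, h x ∂padicHaar p := by
  have key := lintegral_inv_mulPadicHaar (p := p) (h := fun x => h x * normPow 1 x) (by fun_prop)
  rw [lintegral_mulPadicHaar (by fun_prop), lintegral_mulPadicHaar (by fun_prop)] at key
  refine Eq.trans (lintegral_congr fun x => ?_) (key.trans (lintegral_congr fun x => ?_))
  · rw [normPow_inv, mul_left_comm, ← normPow_add]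
    norm_num
  · rcases eq_or_ne x 0 with rfl | hx
    · simp [h0]
    · rw [mul_left_comm, ← normPow_add, normPow_of_ne hx]
      norm_num

/-- The Haar measure of `ℤ_p`, as a measure on `ℚ_p`. -/
noncomputable def unitHaar (p : ℕ) [Fact p.Prime] : Measure ℚ_[p] :=
  (padicHaar p).restrict (Metric.closedBall 0 1)

instance : IsProbabilityMeasure (unitHaar p) :=
  ⟨by rw [unitHaar, Measure.restrict_apply_univ, padicHaar_closedBall_one]⟩

lemma ae_unitHaar_norm_le_one : ∀ᵐ x ∂unitHaar p, ‖x‖ ≤ 1 :=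
  (ae_restrict_mem Metric.isClosed_closedBall.measurableSet).mono
    fun _ hx => mem_closedBall_zero_iff.1 hx

lemma setLIntegral_ball_one {h : ℚ_[p] → ℝ≥0∞} (hh : Measurable h) (a : ℚ_[p]) :
    ∫⁻ x in Metric.ball a 1, h x ∂padicHaar p =
      (p : ℝ≥0∞)⁻¹ * ∫⁻ y, h (a + p * y) ∂unitHaar p := by
  have hball : MeasurableSet (Metric.ball a 1) := Metric.isOpen_ball.measurableSet
  have mem_ball_iff (y : ℚ_[p]) : a + p * y ∈ Metric.ball a 1 ↔ y ∈ Metric.closedBall 0 1 := by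
    rw [mem_ball_iff_norm, add_sub_cancel_left, norm_p_mul_lt_one_iff, mem_closedBall_zero_iff]
  have dilate := lintegral_mul_left_padicHaar (natCast_padic_ne_zero p)
    (h := fun x => (Metric.ball a 1).indicator h (a + x))
    ((hh.indicator hball).comp (measurable_const_add a))
  rw [lintegral_add_left_eq_self ((Metric.ball a 1).indicator h), enorm_natCast_prime, inv_inv]
    at dilate
  calc ∫⁻ x in Metric.ball a 1, h x ∂padicHaar p
      = (p : ℝ≥0∞)⁻¹ * (p * ∫⁻ x, (Metric.ball a 1).indicator h x ∂padicHaar p) := by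
        rw [← mul_assoc, ENNReal.inv_mul_cancel (natCast_ennreal_ne_zero p)
          (ENNReal.natCast_ne_top p), one_mul, lintegral_indicator hball]
    _ = (p : ℝ≥0∞)⁻¹ * ∫⁻ y, h (a + p * y) ∂unitHaar p := by
        rw [← dilate, unitHaar, ← lintegral_indicator Metric.isClosed_closedBall.measurableSet]
        classical simp only [Set.indicator_apply, mem_ball_iff]

lemma lintegral_unitHaar {h : ℚ_[p] → ℝ≥0∞} (hh : Measurable h) :
    ∫⁻ x, h x ∂unitHaar p =
      ∑ a : Fin p, (p : ℝ≥0∞)⁻¹ * ∫⁻ y, h ((a : ℕ) + p * y) ∂unitHaar p := by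
  conv_lhs => rw [unitHaar, closedBall_eq_iUnion_ball_natCast, lintegral_iUnion
    (fun _ => Metric.isOpen_ball.measurableSet) pairwise_disjoint_ball_natCast, tsum_fintype]
  exact Finset.sum_congr rfl fun a _ => setLIntegral_ball_one hh _

lemma setLIntegral_compl_closedBall_one {h : ℚ_[p] → ℝ≥0∞} (hh : Measurable h) :
    ∫⁻ x in (Metric.closedBall 0 1)ᶜ, h x ∂padicHaar p =
      (p : ℝ≥0∞)⁻¹ * ∫⁻ y, h (p * y)⁻¹ * normPow (-2) (p * y) ∂unitHaar p := by
  have hB : MeasurableSet (Metric.closedBall (0 : ℚ_[p]) 1)ᶜ :=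
    Metric.isClosed_closedBall.measurableSet.compl
  have near_zero :=
    setLIntegral_ball_one (p := p) (h := fun x => h x⁻¹ * normPow (-2) x) (by fun_prop) 0
  simp only [zero_add] at near_zero
  rw [← near_zero, ← lintegral_indicator hB,
    ← lintegral_inv_padicHaar (hh.indicator hB) (by simp),
    ← lintegral_indicator Metric.isOpen_ball.measurableSet]
  refine lintegral_congr fun x => ?_
  rcases eq_or_ne x 0 with rfl | hx
  · simp
  have inv_mem_iff : x⁻¹ ∈ (Metric.closedBall (0 : ℚ_[p]) 1)ᶜ ↔ x ∈ Metric.ball 0 1 := by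
    simp [one_lt_inv₀ (norm_pos_iff.2 hx)]
  classical
  simp only [Set.indicator_apply, inv_mem_iff, ite_mul, zero_mul]

/-- The parametrization by `ℤ_p` of the residue disc of `ℙ¹(ℚ_p)` at a point of `ℙ¹(𝔽_p)`, which is
encoded by its representative in `{0, …, p-1}` or, for the point at infinity, by `none`. -/
noncomputable def chart : Option (Fin p) → ℚ_[p] → ℚ_[p]
  | some a, y => (a : ℕ) + p * y
  | none, y => (p * y)⁻¹

/-- The density of the Haar measure of `ℚ_p` in the chart `chart c`. -/
noncomputable def chartDensity : Option (Fin p) → ℚ_[p] → ℝ≥0∞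
  | some _, _ => (p : ℝ≥0∞)⁻¹
  | none, y => (p : ℝ≥0∞)⁻¹ * normPow (-2) ((p : ℚ_[p]) * y)

@[fun_prop]
lemma measurable_chart (c : Option (Fin p)) : Measurable (chart c) := by
  cases c with
  | some a => unfold chart; fun_prop
  | none => exact measurable_inv.comp (measurable_const_mul _)

@[fun_prop]
lemma measurable_chartDensity (c : Option (Fin p)) : Measurable (chartDensity c) := by
  cases c <;> unfold chartDensity <;> fun_prop

lemma lintegral_padicHaar {h : ℚ_[p] → ℝ≥0∞} (hh : Measurable h) :
    ∫⁻ x, h x ∂padicHaar p =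
      ∑ c : Option (Fin p), ∫⁻ y, h (chart c y) * chartDensity c y ∂unitHaar p := by
  rw [← lintegral_add_compl h (Metric.isClosed_closedBall (x := 0) (ε := 1)).measurableSet,
    setLIntegral_compl_closedBall_one hh, ← unitHaar, lintegral_unitHaar hh, Fintype.sum_option,
    add_comm]
  congr 1
  · rw [← lintegral_const_mul _ (by fun_prop)]
    exact lintegral_congr fun y => mul_left_comm _ _ _
  · refine Finset.sum_congr rfl fun a _ => ?_
    rw [mul_comm, ← lintegral_mul_const _ (by fun_prop)]
    rfl

lemma norm_chart_some_le_one (a : Fin p) {y : ℚ_[p]} (hy : ‖y‖ ≤ 1) : ‖chart (some a) y‖ ≤ 1 :=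
  (Padic.nonarchimedean _ _).trans
    (max_le (norm_natCast_le_one a) (norm_p_mul_lt_one_iff.2 hy).le)

lemma chart_some_sub (a : Fin p) (x y : ℚ_[p]) :
    chart (some a) x - chart (some a) y = p * (x - y) := by
  simp only [chart]
  ring

lemma norm_chart_some_sub_of_ne {a b : Fin p} (hab : a ≠ b) {x y : ℚ_[p]} (hx : ‖x‖ ≤ 1)
    (hy : ‖y‖ ≤ 1) : ‖chart (some a) x - chart (some b) y‖ = 1 := by
  have hres := norm_natCast_sub_natCast hab
  have hsmall : ‖(p : ℚ_[p]) * (x - y)‖ < 1 := norm_p_mul_lt_one_iff.2 (norm_sub_le_one hx hy)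
  have hsub : chart (some a) x - chart (some b) y =
      (((a : ℕ) : ℚ_[p]) - ((b : ℕ) : ℚ_[p])) + p * (x - y) := by
    simp only [chart]
    ring
  rw [hsub, Padic.add_eq_max_of_ne (by rw [hres]; exact hsmall.ne'), hres, max_eq_left hsmall.le]

end PadicHaar

/-! ## Product measures -/

section ProductMeasure

variable {κ X C : Type*} [Fintype κ] [MeasurableSpace X] {ν : κ → Measure X}
  [∀ i, IsProbabilityMeasure (ν i)]

lemma lintegral_pi_prod {f : κ → X → ℝ≥0∞} (hf : ∀ i, Measurable (f i)) :
    ∫⁻ y, ∏ i, f i (y i) ∂Measure.pi ν = ∏ i, ∫⁻ y, f i y ∂ν i := by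
  have hind := ProbabilityTheory.iIndepFun_pi (μ := ν) (X := f) fun i => (hf i).aemeasurable
  rw [ProbabilityTheory.lintegral_prod_eq_prod_lintegral_of_indepFun _ _ hind
    fun i => (hf i).comp (measurable_pi_apply i)]
  exact Finset.prod_congr rfl fun i _ => (measurePreserving_eval ν i).lintegral_comp (hf i)

lemma lintegral_sum_map_withDensity {Y : Type*} [MeasurableSpace Y] [Fintype C] {μ : Measure Y}
    {φ : C → Y → X} (hφ : ∀ c, Measurable (φ c)) {d : C → Y → ℝ≥0∞} (hd : ∀ c, Measurable (d c))
    {h : X → ℝ≥0∞} (hh : Measurable h) :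
    ∫⁻ x, h x ∂(∑ c, (μ.withDensity (d c)).map (φ c)) = ∑ c, ∫⁻ y, h (φ c y) * d c y ∂μ := by
  rw [lintegral_finsetSum_measure]
  refine Finset.sum_congr rfl fun c _ => ?_
  rw [lintegral_map hh (hφ c)]
  exact (lintegral_withDensity_eq_lintegral_mul _ (hd c) (hh.comp (hφ c))).trans
    (lintegral_congr fun y => mul_comm _ _)

variable [DecidableEq κ] [Fintype C] {m : κ → Measure X} [∀ i, SigmaFinite (m i)]
  {φ : C → X → X} {d : κ → C → X → ℝ≥0∞}

lemma pi_eq_sum_map_withDensity (hφ : ∀ c, Measurable (φ c)) (hd : ∀ i c, Measurable (d i c))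
    (hm : ∀ i, m i = ∑ c, ((ν i).withDensity (d i c)).map (φ c)) :
    Measure.pi m = ∑ c : κ → C,
      ((Measure.pi ν).withDensity fun y => ∏ i, d i (c i) (y i)).map
        fun y i => φ (c i) (y i) := by
  refine Measure.pi_eq fun s hs => ?_
  have hs1 (i : κ) : Measurable ((s i).indicator (1 : X → ℝ≥0∞)) := measurable_one.indicator (hs i)
  have apply_box (i : κ) :
      m i (s i) = ∑ c, ∫⁻ y, (s i).indicator 1 (φ c y) * d i c y ∂ν i := by
    rw [← lintegral_indicator_one (hs i), hm i, lintegral_sum_map_withDensity hφ (hd i) (hs1 i)]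
  rw [← lintegral_indicator_one (MeasurableSet.univ_pi hs), lintegral_sum_map_withDensity
    (by fun_prop) (by fun_prop) (measurable_one.indicator (MeasurableSet.univ_pi hs))]
  simp_rw [apply_box]
  rw [Finset.prod_univ_sum, Fintype.piFinset_univ]
  refine Finset.sum_congr rfl fun c _ => ?_
  rw [← lintegral_pi_prod (ν := ν) (f := fun i y => (s i).indicator 1 (φ (c i) y) * d i (c i) y)
    fun i => ((hs1 i).comp (hφ _)).mul (hd _ _)]
  refine lintegral_congr fun y => ?_
  rw [Finset.prod_mul_distrib]
  congr 1
  classical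
  simp only [Set.indicator_apply, Set.mem_univ_pi, Pi.one_apply, Finset.prod_ite_zero,
    Finset.mem_univ, true_implies, Finset.prod_const_one]

lemma lintegral_pi_eq_sum (hφ : ∀ c, Measurable (φ c)) (hd : ∀ i c, Measurable (d i c))
    (hm : ∀ i, ∀ h : X → ℝ≥0∞, Measurable h →
      ∫⁻ x, h x ∂m i = ∑ c, ∫⁻ y, h (φ c y) * d i c y ∂ν i)
    {h : (κ → X) → ℝ≥0∞} (hh : Measurable h) :
    ∫⁻ x, h x ∂Measure.pi m =
      ∑ c : κ → C, ∫⁻ y, h (fun i => φ (c i) (y i)) * ∏ i, d i (c i) (y i) ∂Measure.pi ν := by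
  rw [pi_eq_sum_map_withDensity hφ hd fun i => Measure.ext_of_lintegral _ fun h hh => by
    rw [hm i h hh, lintegral_sum_map_withDensity hφ (hd i) hh],
    lintegral_sum_map_withDensity (by fun_prop) (by fun_prop) hh]

end ProductMeasure

section Blocks

variable {κ X C : Type*} [Fintype κ] [MeasurableSpace X] {ν : κ → Measure X}
  [∀ i, IsProbabilityMeasure (ν i)]

lemma comp_updateFinset_restrict_of_dependsOn {κ X W : Type*} [DecidableEq κ] {f : (κ → X) → W}
    {S : Finset κ} (hf : DependsOn f S) (x₀ : κ → X) :
    (fun z => f (Function.updateFinset x₀ S z)) ∘ S.restrict = f := by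
  funext y
  refine hf fun i hi => ?_
  simp [Function.updateFinset, Finset.mem_coe.1 hi]

lemma indepFun_pi_of_dependsOn {Y Z : Type*} [MeasurableSpace Y] [MeasurableSpace Z]
    [hX : Nonempty X] {S T : Finset κ} (hST : Disjoint S T) {f : (κ → X) → Y} {g : (κ → X) → Z}
    (hf : Measurable f) (hg : Measurable g) (hfS : DependsOn f S) (hgT : DependsOn g T) :
    ProbabilityTheory.IndepFun f g (Measure.pi ν) := by
  classical
  obtain ⟨x₀⟩ := hX
  rw [← comp_updateFinset_restrict_of_dependsOn hfS fun _ => x₀,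
    ← comp_updateFinset_restrict_of_dependsOn hgT fun _ => x₀]
  have hind : ProbabilityTheory.iIndepFun (fun i (y : κ → X) => y i) (Measure.pi ν) :=
    ProbabilityTheory.iIndepFun_pi (μ := ν) (X := fun _ x => x) fun i => aemeasurable_id
  exact (hind.indepFun_finset S T hST fun i => measurable_pi_apply i).comp
    (hf.comp measurable_updateFinset) (hg.comp measurable_updateFinset)

lemma lintegral_pi_prod_of_dependsOn [Nonempty X] {B : C → Finset κ}
    (hB : Pairwise (Function.onFun Disjoint B)) {f : C → (κ → X) → ℝ≥0∞}
    (hf : ∀ c, Measurable (f c)) (hdep : ∀ c, DependsOn (f c) (B c)) (s : Finset C) :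
    ∫⁻ y, ∏ c ∈ s, f c y ∂Measure.pi ν = ∏ c ∈ s, ∫⁻ y, f c y ∂Measure.pi ν := by
  classical
  induction s using Finset.induction_on with
  | empty => simp
  | insert c s hc ih =>
    have dependsOn_rest : DependsOn (fun y => ∏ c ∈ s, f c y) (s.biUnion B : Finset κ) :=
      fun x y hxy => Finset.prod_congr rfl fun c hc => hdep c fun i hi =>
        hxy i (Finset.mem_coe.2 (Finset.mem_biUnion.2 ⟨c, hc, hi⟩))
    have disjoint_rest : Disjoint (B c) (s.biUnion B) :=
      (Finset.disjoint_biUnion_right _ _ _).2 fun c' hc' => hB (ne_of_mem_of_not_mem hc' hc).symm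
    have hmeas : Measurable fun y => ∏ c ∈ s, f c y := by fun_prop
    simp only [Finset.prod_insert hc, ← ih]
    exact ProbabilityTheory.lintegral_mul_eq_lintegral_mul_lintegral_of_indepFun (hf c) hmeas
      (indepFun_pi_of_dependsOn disjoint_rest (hf c) hmeas (hdep c) dependsOn_rest)

end Blocks

/-! ## Means of edge products over marked graphs -/

lemma prod_natCast_rpow_neg {p : ℕ} [Fact p.Prime] {E : Type*} (τ : E → ℝ) (s : Finset E) :
    ∏ e ∈ s, (p : ℝ≥0∞) ^ (-τ e) = (p : ℝ≥0∞) ^ (-∑ e ∈ s, τ e) := by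
  classical
  induction s using Finset.induction_on with
  | empty => simp
  | insert e s he ih =>
    rw [Finset.prod_insert he, Finset.sum_insert he, ih, neg_add,
      ENNReal.rpow_add _ _ (natCast_ennreal_ne_zero p) (ENNReal.natCast_ne_top p)]

/-- A graph without loops, some of whose vertices are marked. The vertices stand for points of
`ℚ_p`, the marked ones being fixed at `0`. -/
structure MarkedGraph (ι E : Type*) where
  src : E → ι
  dst : E → ι
  ne : ∀ e, src e ≠ dst e
  marks : Finset ι

namespace MarkedGraph

section Edges

variable {p : ℕ} [hp : Fact p.Prime] {ι E C : Type*} [DecidableEq ι] [Fintype E]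
  (G : MarkedGraph ι E) (τ : E → ℝ)

/-- The edges between the vertices of `B`. -/
def edges (B : Finset ι) : Finset E := {e | G.src e ∈ B ∧ G.dst e ∈ B}

lemma edges_eq_empty {B : Finset ι} (hB : B.card ≤ 1) : G.edges B = ∅ :=
  Finset.filter_eq_empty_iff.2 fun e _ h => G.ne e (Finset.card_le_one.1 hB _ h.1 _ h.2)

/-- The product of the powers `|x_i - x_j|^{τ_e}` over the edges `e = {i, j}` in `B`. -/
noncomputable def edgeProd (B : Finset ι) (x : ι → ℚ_[p]) : ℝ≥0∞ :=
  ∏ e ∈ G.edges B, normPow (τ e) (x (G.src e) - x (G.dst e))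

lemma measurable_edgeProd (B : Finset ι) : Measurable (G.edgeProd (p := p) τ B) := by
  unfold edgeProd
  fun_prop

lemma dependsOn_edgeProd (B : Finset ι) : DependsOn (G.edgeProd (p := p) τ B) B := by
  refine fun x y hxy => Finset.prod_congr rfl fun e he => ?_
  obtain ⟨hsrc, hdst⟩ := (Finset.mem_filter.1 he).2
  rw [hxy _ hsrc, hxy _ hdst]

lemma edgeProd_eq_one {B : Finset ι} (hB : B.card ≤ 1) (x : ι → ℚ_[p]) :
    G.edgeProd τ B x = 1 := by
  rw [edgeProd, G.edges_eq_empty hB, Finset.prod_empty]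

variable (p) in
/-- The factor by which `edgeProd` changes under the dilation by `p`. -/
noncomputable def scale (B : Finset ι) : ℝ≥0∞ := (p : ℝ≥0∞) ^ (-∑ e ∈ G.edges B, τ e)

omit hp in
lemma scale_eq_one {B : Finset ι} (hB : B.card ≤ 1) : G.scale p τ B = 1 := by
  simp [scale, G.edges_eq_empty hB]

lemma scale_mul_edgeProd (B : Finset ι) (x : ι → ℚ_[p]) :
    G.scale p τ B * G.edgeProd τ B x =
      ∏ e ∈ G.edges B, normPow (τ e) ((p : ℚ_[p]) * (x (G.src e) - x (G.dst e))) := by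
  simp_rw [normPow_mul, normPow_natCast_prime, Finset.prod_mul_distrib, prod_natCast_rpow_neg]
  rfl

lemma prod_edges_ite_eq_prod_blocks [Fintype C] [DecidableEq C] (c : ι → C) (B : Finset ι)
    (y : ι → ℚ_[p]) :
    ∏ e ∈ G.edges B, (if c (G.src e) = c (G.dst e)
        then normPow (τ e) ((p : ℚ_[p]) * (y (G.src e) - y (G.dst e))) else 1) =
      ∏ a, (G.scale p τ {i ∈ B | c i = a} * G.edgeProd τ {i ∈ B | c i = a} y) := by
  have edges_block (a : C) : G.edges {i ∈ B | c i = a} =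
      {e ∈ {e ∈ G.edges B | c (G.src e) = c (G.dst e)} | c (G.src e) = a} := by
    ext e
    simp only [edges, Finset.mem_filter, Finset.mem_univ, true_and]
    grind
  simp_rw [scale_mul_edgeProd, edges_block]
  rw [Finset.prod_fiberwise, Finset.prod_filter]

end Edges

section Residues

variable {p : ℕ} [hp : Fact p.Prime] {ι E : Type*}

/-- The points with residues `c` whose relative positions in their residue classes are `y`. -/
noncomputable def residueMap (c : ι → Fin p) (y : ι → ℚ_[p]) : ι → ℚ_[p] :=
  fun i => chart (some (c i)) (y i)

@[fun_prop]
lemma measurable_residueMap (c : ι → Fin p) : Measurable (residueMap c) := by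
  unfold residueMap
  fun_prop

variable [DecidableEq ι] [Fintype E] (G : MarkedGraph ι E) (τ : E → ℝ)

lemma edgeProd_residueMap (B : Finset ι) (c : ι → Fin p) {y : ι → ℚ_[p]} (hy : ∀ i, ‖y i‖ ≤ 1) :
    G.edgeProd τ B (residueMap c y) =
      ∏ a, (G.scale p τ {i ∈ B | c i = a} * G.edgeProd τ {i ∈ B | c i = a} y) := by
  rw [← prod_edges_ite_eq_prod_blocks]
  refine Finset.prod_congr rfl fun e _ => ?_
  unfold residueMap
  split_ifs with he
  · rw [he, chart_some_sub]
  · exact normPow_eq_one (norm_chart_some_sub_of_ne he (hy _) (hy _)) _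

end Residues

section Measure

variable {p : ℕ} [hp : Fact p.Prime] {ι E : Type*} [DecidableEq ι] (G : MarkedGraph ι E)

variable (p) in
/-- The law of a uniformly distributed point of `ℤ_p`, or of `0` if the vertex `i` is marked. -/
noncomputable def pointMeasure (i : ι) : Measure ℚ_[p] :=
  if i ∈ G.marks then Measure.dirac 0 else unitHaar p

instance (i : ι) : IsProbabilityMeasure (G.pointMeasure p i) := by
  unfold pointMeasure; split_ifs <;> infer_instance

/-- The probability that the `i`-th point lies in the residue class `a`. -/
noncomputable def weight (i : ι) (a : Fin p) : ℝ≥0∞ :=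
  if i ∈ G.marks then (if (a : ℕ) = 0 then 1 else 0) else (p : ℝ≥0∞)⁻¹

lemma lintegral_pointMeasure (i : ι) {h : ℚ_[p] → ℝ≥0∞} (hh : Measurable h) :
    ∫⁻ x, h x ∂G.pointMeasure p i =
      ∑ a : Fin p, ∫⁻ y, h (chart (some a) y) * G.weight i a ∂G.pointMeasure p i := by
  have : NeZero p := ⟨hp.1.ne_zero⟩
  unfold pointMeasure weight
  split_ifs
  · rw [Finset.sum_eq_single 0 (fun a _ ha => by simp [Fin.val_eq_zero_iff, ha]) (by simp)]
    simp [chart]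
  · rw [lintegral_unitHaar hh]
    refine Finset.sum_congr rfl fun a _ => ?_
    rw [lintegral_mul_const _ (by fun_prop), mul_comm]
    rfl

lemma sum_weight (i : ι) : ∑ a : Fin p, G.weight i a = 1 := by
  have h := G.lintegral_pointMeasure (p := p) i (h := fun _ => 1) measurable_const
  simpa using h.symm

lemma ae_pointMeasure_norm_le_one (i : ι) : ∀ᵐ x ∂G.pointMeasure p i, ‖x‖ ≤ 1 := by
  unfold pointMeasure
  split_ifs
  · rw [ae_dirac_iff (isClosed_le continuous_norm continuous_const).measurableSet]
    simp
  · exact ae_unitHaar_norm_le_one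

variable [Fintype ι]

variable (p) in
/-- The joint law of independent points with the laws `pointMeasure`. -/
noncomputable def measure : Measure (ι → ℚ_[p]) := Measure.pi (G.pointMeasure p)

instance : IsProbabilityMeasure (G.measure p) := by unfold measure; infer_instance

lemma ae_measure_norm_le_one : ∀ᵐ y ∂G.measure p, ∀ i, ‖y i‖ ≤ 1 :=
  ae_all_iff.2 fun i => (measurePreserving_eval (G.pointMeasure p) i).quasiMeasurePreserving.ae
    (G.ae_pointMeasure_norm_le_one i)

lemma lintegral_measure {h : (ι → ℚ_[p]) → ℝ≥0∞} (hh : Measurable h) :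
    ∫⁻ x, h x ∂G.measure p = ∑ c : ι → Fin p,
      (∏ i, G.weight i (c i)) * ∫⁻ y, h (residueMap c y) ∂G.measure p := by
  unfold measure
  rw [lintegral_pi_eq_sum (d := fun i a _ => G.weight i a) (fun a => measurable_chart (some a))
    (fun _ _ => measurable_const) (fun i h hh => G.lintegral_pointMeasure i hh) hh]
  refine Finset.sum_congr rfl fun c _ => ?_
  rw [mul_comm]
  exact lintegral_mul_const _ (hh.comp (measurable_residueMap c))

end Measure

section ConstOn

variable {p : ℕ} [hp : Fact p.Prime] {ι E C : Type*}

/-- All points of `B` are in the same class. -/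
def ConstOn (B : Finset ι) (c : ι → C) : Prop := ∃ a, ∀ i ∈ B, c i = a

lemma filter_ssubset_of_not_constOn [DecidableEq C] {B : Finset ι} {c : ι → C}
    (hc : ¬ ConstOn B c) (a : C) : ({i ∈ B | c i = a} : Finset ι) ⊂ B :=
  (Finset.filter_subset _ _).ssubset_of_ne fun h => hc ⟨a, Finset.filter_eq_self.1 h⟩

lemma exists_ne_of_not_constOn {B : Finset ι} (hB : B.Nonempty) {c : ι → C}
    (hc : ¬ ConstOn B c) : ∃ i ∈ B, ∃ j ∈ B, c i ≠ c j := by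
  obtain ⟨j, hj⟩ := hB
  by_contra! h
  exact hc ⟨c j, fun i hi => h i hi j hj⟩

variable [DecidableEq ι] (G : MarkedGraph ι E)

lemma prod_blocks_of_constOn [Fintype E] (τ : E → ℝ) {B : Finset ι} {c : ι → Fin p}
    (hc : ConstOn B c) (y : ι → ℚ_[p]) :
    ∏ a, (G.scale p τ {i ∈ B | c i = a} * G.edgeProd τ {i ∈ B | c i = a} y) =
      G.scale p τ B * G.edgeProd τ B y := by
  obtain ⟨a, ha⟩ := hc
  rw [Finset.prod_eq_single_of_mem a (Finset.mem_univ a), Finset.filter_true_of_mem ha]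
  intro b _ hb
  rw [Finset.filter_false_of_mem fun i hi h => hb (h.symm.trans (ha i hi)),
    G.scale_eq_one _ (by simp), G.edgeProd_eq_one _ (by simp), one_mul]

lemma sum_prod_weight_eq_rpow {B : Finset ι} (hB : B.Nonempty) (hM : (B ∩ G.marks).card ≤ 1) :
    ∑ a : Fin p, ∏ i ∈ B, G.weight i a = (p : ℝ≥0∞) ^ (1 - (B.card : ℝ)) := by
  obtain ⟨j, hj, hmarks⟩ : ∃ j ∈ B, ∀ i ∈ B.erase j, i ∉ G.marks := by
    rcases (B ∩ G.marks).eq_empty_or_nonempty with h0 | ⟨j, hj⟩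
    · obtain ⟨j, hj⟩ := hB
      exact ⟨j, hj, fun i hi hiM => Finset.notMem_empty i
        (h0 ▸ Finset.mem_inter.2 ⟨Finset.mem_of_mem_erase hi, hiM⟩)⟩
    · exact ⟨j, (Finset.mem_inter.1 hj).1, fun i hi hiM => Finset.ne_of_mem_erase hi
        (Finset.card_le_one.1 hM _ (Finset.mem_inter.2 ⟨Finset.mem_of_mem_erase hi, hiM⟩) _ hj)⟩
  have prod_weight (a : Fin p) :
      ∏ i ∈ B, G.weight i a = G.weight j a * (p : ℝ≥0∞)⁻¹ ^ (B.card - 1) := by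
    rw [← Finset.mul_prod_erase B _ hj, ← Finset.card_erase_of_mem hj]
    exact congrArg _ (Finset.prod_eq_pow_card fun i hi => if_neg (hmarks i hi))
  simp_rw [prod_weight]
  rw [← Finset.sum_mul, sum_weight, one_mul, ← ENNReal.inv_pow, ← ENNReal.rpow_natCast,
    ← ENNReal.rpow_neg, Nat.cast_sub (Finset.card_pos.2 hB), Nat.cast_one, neg_sub]

variable [Fintype ι]

lemma sum_prod_weight_of_forall_eq (B : Finset ι) (a : Fin p) :
    ∑ c : ι → Fin p with ∀ i ∈ B, c i = a, ∏ i, G.weight i (c i) = ∏ i ∈ B, G.weight i a := by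
  calc ∑ c : ι → Fin p with ∀ i ∈ B, c i = a, ∏ i, G.weight i (c i)
      = ∑ c : ι → Fin p, ∏ i, (if i ∈ B → c i = a then G.weight i (c i) else 0) := by
        rw [Finset.sum_filter]
        exact Finset.sum_congr rfl fun c _ => by simp [Finset.prod_ite_zero]
    _ = ∏ i, ∑ b : Fin p, (if i ∈ B → b = a then G.weight i b else 0) := by
        rw [Finset.prod_univ_sum, Fintype.piFinset_univ]
    _ = ∏ i ∈ B, G.weight i a := by
        rw [← Finset.prod_subset (Finset.subset_univ B) fun i _ hi => by simp [hi, sum_weight]]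
        exact Finset.prod_congr rfl fun i hi => by simp [hi]

open Classical in
lemma sum_prod_weight_constOn {B : Finset ι} (hB : B.Nonempty) :
    ∑ c : ι → Fin p with ConstOn B c, ∏ i, G.weight i (c i) =
      ∑ a : Fin p, ∏ i ∈ B, G.weight i a := by
  obtain ⟨j, hj⟩ := hB
  have common_class (c : ι → Fin p) (a : Fin p) :
      (∀ i ∈ B, c i = a) ↔ ConstOn B c ∧ c j = a :=
    ⟨fun h => ⟨⟨a, h⟩, h j hj⟩, fun ⟨⟨b, hb⟩, ha⟩ i hi => (hb i hi).trans ((hb j hj).symm.trans ha)⟩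
  rw [← Finset.sum_fiberwise _ (fun c => c j)]
  refine Finset.sum_congr rfl fun a _ => ?_
  rw [← sum_prod_weight_of_forall_eq, Finset.filter_filter]
  exact Finset.sum_congr (Finset.filter_congr fun c _ => (common_class c a).symm) fun _ _ => rfl

end ConstOn

section Clusters

variable {p : ℕ} [hp : Fact p.Prime] {ι : Type*}

variable (p) in
/-- The configurations whose points in `B` are all congruent modulo `p ^ k`. -/
def cluster (B : Finset ι) (k : ℕ) : Set (ι → ℚ_[p]) :=
  {x | ∀ i ∈ B, ∀ j ∈ B, ‖x i - x j‖ ≤ ‖(p : ℚ_[p])‖ ^ k}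

variable (p) in
/-- The configurations whose points in `B` are congruent modulo `p ^ k` but not modulo
`p ^ (k + 1)`. -/
def shell (B : Finset ι) (k : ℕ) : Set (ι → ℚ_[p]) := cluster p B k \ cluster p B (k + 1)

lemma measurableSet_cluster (B : Finset ι) (k : ℕ) : MeasurableSet (cluster p B k) := by
  have : cluster p B k = ⋂ i ∈ B, ⋂ j ∈ B, {x | ‖x i - x j‖ ≤ ‖(p : ℚ_[p])‖ ^ k} := by
    ext x
    simp [cluster]
  rw [this]
  exact B.measurableSet_biInter fun i _ => B.measurableSet_biInter fun j _ =>
    measurableSet_le (by fun_prop) measurable_const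

lemma measurableSet_shell (B : Finset ι) (k : ℕ) : MeasurableSet (shell p B k) :=
  (measurableSet_cluster B k).diff (measurableSet_cluster B (k + 1))

lemma mem_cluster_zero (B : Finset ι) {x : ι → ℚ_[p]} (hx : ∀ i, ‖x i‖ ≤ 1) :
    x ∈ cluster p B 0 := by
  intro i _ j _
  rw [pow_zero]
  exact norm_sub_le_one (hx i) (hx j)

lemma antitone_cluster (B : Finset ι) : Antitone (cluster p B) := fun _ _ hkl _ hx i hi j hj =>
  (hx i hi j hj).trans (pow_le_pow_of_le_one (norm_nonneg _) Padic.norm_p_lt_one.le hkl)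

lemma pairwise_disjoint_shell (B : Finset ι) :
    Pairwise (Function.onFun Disjoint (shell p B)) := by
  refine (pairwise_disjoint_on _).2 fun k l hkl => Set.disjoint_left.2 fun x hk hl => ?_
  exact hk.2 (antitone_cluster B hkl hl.1)

lemma exists_mem_shell {B : Finset ι} {x : ι → ℚ_[p]} (hx : ∀ i, ‖x i‖ ≤ 1) {i j : ι}
    (hi : i ∈ B) (hj : j ∈ B) (hij : x i ≠ x j) : ∃ k, x ∈ shell p B k := by
  obtain ⟨n, hn⟩ := exists_pow_lt_of_lt_one (norm_pos_iff.2 (sub_ne_zero.2 hij))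
    (Padic.norm_p_lt_one (p := p))
  by_contra! h
  have mem_cluster (k : ℕ) : x ∈ cluster p B k := by
    induction k with
    | zero => exact mem_cluster_zero B hx
    | succ k ih => exact by_contra fun hk => h k ⟨ih, hk⟩
  exact hn.not_ge (mem_cluster n i hi j hj)

lemma residueMap_mem_cluster_succ {B : Finset ι} {c : ι → Fin p} (hc : ConstOn B c) (k : ℕ)
    (y : ι → ℚ_[p]) : residueMap c y ∈ cluster p B (k + 1) ↔ y ∈ cluster p B k := by
  obtain ⟨a, ha⟩ := hc
  refine forall₄_congr fun i hi j hj => ?_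
  rw [residueMap, residueMap, ha i hi, ha j hj, chart_some_sub, norm_mul, pow_succ',
    mul_le_mul_iff_right₀ (norm_pos_iff.2 (natCast_padic_ne_zero p))]

lemma residueMap_notMem_cluster_succ {B : Finset ι} (hB : B.Nonempty) {c : ι → Fin p}
    (hc : ¬ ConstOn B c) (k : ℕ) {y : ι → ℚ_[p]} (hy : ∀ i, ‖y i‖ ≤ 1) :
    residueMap c y ∉ cluster p B (k + 1) := by
  obtain ⟨i, hi, j, hj, hij⟩ := exists_ne_of_not_constOn hB hc
  intro h
  have hle := h i hi j hj
  rw [residueMap, residueMap, norm_chart_some_sub_of_ne hij (hy i) (hy j)] at hle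
  exact hle.not_gt (pow_lt_one₀ (norm_nonneg _) Padic.norm_p_lt_one k.succ_ne_zero)

lemma residueMap_mem_shell_zero {B : Finset ι} (hB : B.Nonempty) (c : ι → Fin p)
    {y : ι → ℚ_[p]} (hy : ∀ i, ‖y i‖ ≤ 1) : residueMap c y ∈ shell p B 0 ↔ ¬ ConstOn B c := by
  refine ⟨fun h hc => h.2 ((residueMap_mem_cluster_succ hc 0 y).2 (mem_cluster_zero B hy)),
    fun hc => ⟨mem_cluster_zero B fun i => norm_chart_some_le_one _ (hy i),
      residueMap_notMem_cluster_succ hB hc 0 hy⟩⟩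

lemma residueMap_mem_shell_succ {B : Finset ι} (hB : B.Nonempty) (k : ℕ) (c : ι → Fin p)
    {y : ι → ℚ_[p]} (hy : ∀ i, ‖y i‖ ≤ 1) :
    residueMap c y ∈ shell p B (k + 1) ↔ ConstOn B c ∧ y ∈ shell p B k := by
  by_cases hc : ConstOn B c
  · simp only [shell, Set.mem_sdiff, residueMap_mem_cluster_succ hc, hc, true_and]
  · simp only [shell, Set.mem_sdiff, residueMap_notMem_cluster_succ hB hc _ hy, hc, false_and]

end Clusters

section Mean

variable {p : ℕ} [hp : Fact p.Prime] {ι E : Type*} [DecidableEq ι] [Fintype ι] [Fintype E]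
  (G : MarkedGraph ι E) (τ : E → ℝ)

variable (p) in
/-- The mean of `edgeProd` over the random points. -/
noncomputable def mean (B : Finset ι) : ℝ≥0∞ := ∫⁻ x, G.edgeProd τ B x ∂G.measure p

lemma mean_eq_one {B : Finset ι} (hB : B.card ≤ 1) : G.mean p τ B = 1 := by
  simp [mean, G.edgeProd_eq_one τ hB]

lemma lintegral_prod_blocks {C : Type*} [Fintype C] [DecidableEq C] (B : Finset ι) (c : ι → C) :
    ∫⁻ y, ∏ a, (G.scale p τ {i ∈ B | c i = a} * G.edgeProd τ {i ∈ B | c i = a} y) ∂G.measure p =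
      ∏ a, (G.scale p τ {i ∈ B | c i = a} * G.mean p τ {i ∈ B | c i = a}) := by
  simp_rw [Finset.prod_mul_distrib]
  rw [lintegral_const_mul _ (Finset.measurable_fun_prod _ fun a _ => G.measurable_edgeProd τ _)]
  congr 1
  exact lintegral_pi_prod_of_dependsOn (B := fun a => {i ∈ B | c i = a})
    (fun a b hab => Finset.disjoint_filter.2 fun i _ ha hb => hab (ha.symm.trans hb))
    (fun a => G.measurable_edgeProd τ _) (fun a => G.dependsOn_edgeProd τ _) _

lemma setLIntegral_edgeProd (B : Finset ι) {S : Set (ι → ℚ_[p])} (hS : MeasurableSet S) :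
    ∫⁻ x in S, G.edgeProd τ B x ∂G.measure p = ∑ c : ι → Fin p, (∏ i, G.weight i (c i)) *
      ∫⁻ y in residueMap c ⁻¹' S,
        ∏ a, (G.scale p τ {i ∈ B | c i = a} * G.edgeProd τ {i ∈ B | c i = a} y)
          ∂G.measure p := by
  rw [← lintegral_indicator hS, lintegral_measure _ ((G.measurable_edgeProd τ B).indicator hS)]
  refine Finset.sum_congr rfl fun c _ => ?_
  rw [← lintegral_indicator (measurable_residueMap c hS)]
  congr 1
  refine lintegral_congr_ae (G.ae_measure_norm_le_one.mono fun y hy => ?_)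
  classical
  simp only [Set.indicator_apply, Set.mem_preimage, edgeProd_residueMap G τ B c hy]

open Classical in
variable (p) in
/-- The contribution to `mean` of the configurations whose points in `B` do not all lie in the
same residue class. -/
noncomputable def rest (B : Finset ι) : ℝ≥0∞ :=
  ∑ c : ι → Fin p with ¬ ConstOn B c, (∏ i, G.weight i (c i)) *
    ∏ a, (G.scale p τ {i ∈ B | c i = a} * G.mean p τ {i ∈ B | c i = a})

variable (p) in
/-- The factor by which the contribution of a shell to `mean` changes from each shell to the
next. -/
noncomputable def ratio (B : Finset ι) : ℝ≥0∞ :=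
  (p : ℝ≥0∞) ^ (1 - (B.card : ℝ) - ∑ e ∈ G.edges B, τ e)

lemma setLIntegral_shell_zero {B : Finset ι} (hB : B.Nonempty) :
    ∫⁻ x in shell p B 0, G.edgeProd τ B x ∂G.measure p = G.rest p τ B := by
  classical
  rw [G.setLIntegral_edgeProd τ B (measurableSet_shell B 0), rest, Finset.sum_filter]
  refine Finset.sum_congr rfl fun c _ => ?_
  have hae : residueMap c ⁻¹' shell p B 0 =ᵐ[G.measure p] {_y | ¬ ConstOn B c} :=
    G.ae_measure_norm_le_one.mono fun y hy => propext (residueMap_mem_shell_zero hB c hy)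
  rw [setLIntegral_congr hae]
  by_cases hc : ConstOn B c
  · simp [hc]
  · simp [hc, lintegral_prod_blocks]

lemma setLIntegral_shell_succ {B : Finset ι} (hB : B.Nonempty) (hM : (B ∩ G.marks).card ≤ 1)
    (k : ℕ) : ∫⁻ x in shell p B (k + 1), G.edgeProd τ B x ∂G.measure p =
      G.ratio p τ B * ∫⁻ x in shell p B k, G.edgeProd τ B x ∂G.measure p := by
  classical
  have contribution (c : ι → Fin p) : ∫⁻ y in residueMap c ⁻¹' shell p B (k + 1),
      ∏ a, (G.scale p τ {i ∈ B | c i = a} * G.edgeProd τ {i ∈ B | c i = a} y) ∂G.measure p =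
      if ConstOn B c then
        G.scale p τ B * ∫⁻ x in shell p B k, G.edgeProd τ B x ∂G.measure p else 0 := by
    have hae : residueMap c ⁻¹' shell p B (k + 1) =ᵐ[G.measure p]
        {y | ConstOn B c ∧ y ∈ shell p B k} :=
      G.ae_measure_norm_le_one.mono fun y hy => propext (residueMap_mem_shell_succ hB k c hy)
    rw [setLIntegral_congr hae]
    split_ifs with hc
    · simp_rw [prod_blocks_of_constOn G τ hc]
      rw [lintegral_const_mul _ (G.measurable_edgeProd τ B)]
      simp [hc]
    · simp [hc]
  have ratio_eq : G.ratio p τ B = (p : ℝ≥0∞) ^ (1 - (B.card : ℝ)) * G.scale p τ B := by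
    rw [scale, ratio, ← ENNReal.rpow_add _ _ (natCast_ennreal_ne_zero p)
      (ENNReal.natCast_ne_top p), sub_eq_add_neg _ (∑ e ∈ _, _)]
  simp_rw [G.setLIntegral_edgeProd τ B (measurableSet_shell B (k + 1)), contribution, mul_ite,
    mul_zero]
  rw [← Finset.sum_filter, ← Finset.sum_mul, sum_prod_weight_constOn G hB,
    sum_prod_weight_eq_rpow G hB hM, ratio_eq, mul_assoc]

/-- The shells decompose the integral into a geometric series. -/
lemma mean_eq_rest_mul_inv {B : Finset ι} (hM : (B ∩ G.marks).card ≤ 1)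
    (hE : (G.edges B).Nonempty) : G.mean p τ B = G.rest p τ B * (1 - G.ratio p τ B)⁻¹ := by
  obtain ⟨e, he⟩ := hE
  obtain ⟨hsrc, hdst⟩ := (Finset.mem_filter.1 he).2
  have shell_integral (k : ℕ) : ∫⁻ x in shell p B k, G.edgeProd τ B x ∂G.measure p =
      G.rest p τ B * G.ratio p τ B ^ k := by
    induction k with
    | zero => rw [G.setLIntegral_shell_zero τ ⟨_, hsrc⟩, pow_zero, mul_one]
    | succ k ih => rw [G.setLIntegral_shell_succ τ ⟨_, hsrc⟩ hM, ih, pow_succ', mul_left_comm]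
  have support_subset : ∀ᵐ x ∂G.measure p, x ∉ ⋃ k, shell p B k → G.edgeProd τ B x = 0 := by
    refine G.ae_measure_norm_le_one.mono fun x hx hxs => Finset.prod_eq_zero he ?_
    by_contra hne
    have hxe : x (G.src e) ≠ x (G.dst e) := fun h => hne (by rw [h, sub_self, normPow_zero_right])
    exact hxs (Set.mem_iUnion.2 (exists_mem_shell hx hsrc hdst hxe))
  calc G.mean p τ B = ∫⁻ x in ⋃ k, shell p B k, G.edgeProd τ B x ∂G.measure p := by
        rw [mean, ← lintegral_indicator (MeasurableSet.iUnion (measurableSet_shell B))]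
        refine lintegral_congr_ae (support_subset.mono fun x hx => ?_)
        classical
        rw [Set.indicator_apply]
        exact (ite_eq_left_iff.2 fun h => (hx h).symm).symm
    _ = ∑' k, G.rest p τ B * G.ratio p τ B ^ k := by
        rw [lintegral_iUnion (measurableSet_shell B) (pairwise_disjoint_shell B)]
        simp_rw [shell_integral]
    _ = G.rest p τ B * (1 - G.ratio p τ B)⁻¹ := by
        rw [ENNReal.tsum_mul_left, ENNReal.tsum_geometric]

/-- At most one vertex of `B` is marked, and every subset of at least two vertices spans an
edge: the conditions under which the means over all subsets of `B` can be computed recursively. -/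
def Admissible (B : Finset ι) : Prop :=
  (B ∩ G.marks).card ≤ 1 ∧ ∀ K ⊆ B, 2 ≤ K.card → (G.edges K).Nonempty

omit [Fintype ι] in
lemma Admissible.mono {G : MarkedGraph ι E} {B K : Finset ι} (h : G.Admissible B) (hK : K ⊆ B) :
    G.Admissible K :=
  ⟨(Finset.card_le_card (Finset.inter_subset_inter_right hK)).trans h.1,
    fun L hL => h.2 L (hL.trans hK)⟩

lemma mean_mem {Ω : Type*} (S : Subsemiring (Ω → ℝ≥0∞)) (τ : Ω → E → ℝ)
    (hp_inv : (fun _ => (p : ℝ≥0∞)⁻¹) ∈ S) {B : Finset ι} (hB : G.Admissible B)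
    (hscale : ∀ K ⊆ B, 2 ≤ K.card → (fun ω => G.scale p (τ ω) K) ∈ S)
    (hratio : ∀ K ⊆ B, 2 ≤ K.card → (fun ω => (1 - G.ratio p (τ ω) K)⁻¹) ∈ S) :
    (fun ω => G.mean p (τ ω) B) ∈ S := by
  classical
  induction B using Finset.strongInduction with
  | H B ih =>
    rcases le_or_gt B.card 1 with hcard | hcard
    · simp only [mean_eq_one _ _ hcard]
      exact S.one_mem
    have weight_mem (i : ι) (a : Fin p) : (fun _ => G.weight i a) ∈ S := by
      unfold weight
      split_ifs
      exacts [S.one_mem, S.zero_mem, hp_inv]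
    have scale_mem {K : Finset ι} (hK : K ⊆ B) : (fun ω => G.scale p (τ ω) K) ∈ S := by
      rcases le_or_gt K.card 1 with hK1 | hK1
      · simp only [scale_eq_one _ _ hK1]
        exact S.one_mem
      · exact hscale K hK hK1
    have rest_mem : (fun ω => G.rest p (τ ω) B) ∈ S := by
      have : (fun ω => G.rest p (τ ω) B) = ∑ c : ι → Fin p with ¬ ConstOn B c,
          (∏ i, fun _ => G.weight i (c i)) * ∏ a, ((fun ω => G.scale p (τ ω) {i ∈ B | c i = a}) *
            fun ω => G.mean p (τ ω) {i ∈ B | c i = a}) := by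
        ext ω
        simp only [rest, Finset.sum_apply, Pi.mul_apply, Finset.prod_apply]
      rw [this]
      refine S.sum_mem fun c hc => S.mul_mem (S.prod_mem fun i _ => weight_mem i (c i))
        (S.prod_mem fun a _ => ?_)
      have hss := filter_ssubset_of_not_constOn (Finset.mem_filter.1 hc).2 a
      exact S.mul_mem (scale_mem hss.1) (ih _ hss (hB.mono hss.1)
        (fun K hK => hscale K (hK.trans hss.1)) fun K hK => hratio K (hK.trans hss.1))
    simp_rw [G.mean_eq_rest_mul_inv _ hB.1 (hB.2 B subset_rfl hcard)]
    exact S.mul_mem rest_mem (hratio B subset_rfl hcard)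

end Mean

end MarkedGraph

/-! ## Chordal distances and residue discs -/

section ChordalPow

variable {p : ℕ} [hp : Fact p.Prime]

/-- The power `d^t` of the chordal distance `d` of the points with parameters `x` and `y` in the
residue discs `c` and `d` of `ℙ¹(ℚ_p)`. The distance from the point at infinity, which has the
parameter `0` in the disc `none`, is `max(1, |x|)⁻¹`. -/
noncomputable def chordalPow (t : ℝ) (c d : Option (Fin p)) (x y : ℚ_[p]) : ℝ≥0∞ :=
  if c = d then normPow t ((p : ℚ_[p]) * (x - y)) else 1

lemma chordalPow_none_some (t : ℝ) (a : Fin p) (x y : ℚ_[p]) :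
    chordalPow t none (some a) x y = 1 := if_neg (Option.some_ne_none a).symm

lemma chordalPow_none_none (t : ℝ) (x : ℚ_[p]) :
    chordalPow t none none 0 x = normPow t ((p : ℚ_[p]) * x) := by
  rw [chordalPow, if_pos rfl, zero_sub, mul_neg, normPow_neg]

lemma chordalPow_add (s t : ℝ) (c d : Option (Fin p)) (x y : ℚ_[p]) :
    chordalPow (s + t) c d x y = chordalPow s c d x y * chordalPow t c d x y := by
  unfold chordalPow
  split_ifs
  · exact normPow_add s t _
  · rw [one_mul]

lemma chordalPow_zero {c d : Option (Fin p)} {x y : ℚ_[p]} (h : c = d → x ≠ y) :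
    chordalPow 0 c d x y = 1 := by
  unfold chordalPow
  split_ifs with hcd
  · rw [normPow_of_ne (mul_ne_zero (natCast_padic_ne_zero p) (sub_ne_zero.2 (h hcd))),
      ENNReal.rpow_zero]
  · rfl

lemma chordalPow_sum {α : Type*} (s : Finset α) (t : α → ℝ) {c d : Option (Fin p)} {x y : ℚ_[p]}
    (h : c = d → x ≠ y) :
    chordalPow (∑ a ∈ s, t a) c d x y = ∏ a ∈ s, chordalPow (t a) c d x y := by
  classical
  induction s using Finset.induction_on with
  | empty => exact chordalPow_zero h
  | insert a s ha ih => rw [Finset.sum_insert ha, Finset.prod_insert ha, chordalPow_add, ih]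

lemma chartDensity_eq (c : Option (Fin p)) (y : ℚ_[p]) :
    chartDensity c y = (p : ℝ≥0∞)⁻¹ * chordalPow (-2) none c 0 y := by
  cases c with
  | none => rw [chordalPow_none_none, chartDensity]
  | some a => rw [chordalPow_none_some, mul_one, chartDensity]

lemma norm_chart_none_sub_chart_some (a : Fin p) {x y : ℚ_[p]} (hx : ‖x‖ ≤ 1) (hx0 : x ≠ 0)
    (hy : ‖y‖ ≤ 1) : ‖chart none x - chart (some a) y‖ = ‖((p : ℚ_[p]) * x)⁻¹‖ := by
  have hlarge : 1 < ‖((p : ℚ_[p]) * x)⁻¹‖ := by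
    rw [norm_inv]
    exact (one_lt_inv₀ (norm_pos_iff.2 (mul_ne_zero (natCast_padic_ne_zero p) hx0))).2
      (norm_p_mul_lt_one_iff.2 hx)
  have hlt := (norm_chart_some_le_one a hy).trans_lt hlarge
  rw [sub_eq_add_neg, Padic.add_eq_max_of_ne (by rw [norm_neg]; exact hlt.ne'), norm_neg]
  exact max_eq_left hlt.le

lemma normPow_chart_none_sub_chart_some (t : ℝ) (a : Fin p) {x y : ℚ_[p]} (hx : ‖x‖ ≤ 1)
    (hx0 : x ≠ 0) (hy : ‖y‖ ≤ 1) :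
    normPow t (chart none x - chart (some a) y) = normPow (-t) ((p : ℚ_[p]) * x) := by
  rw [normPow_congr (norm_chart_none_sub_chart_some a hx hx0 hy), normPow_inv]

/-- The usual distance of two points is their chordal distance divided by their chordal distances
from infinity. -/
lemma normPow_chart_sub (t : ℝ) {c d : Option (Fin p)} {x y : ℚ_[p]} (hx : ‖x‖ ≤ 1)
    (hy : ‖y‖ ≤ 1) (hx0 : c = none → x ≠ 0) (hy0 : d = none → y ≠ 0) :
    normPow t (chart c x - chart d y) =
      chordalPow (-t) none c 0 x * chordalPow (-t) none d 0 y * chordalPow t c d x y := by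
  cases c with
  | none =>
    cases d with
    | none =>
      have hp0 := natCast_padic_ne_zero p
      have hx1 := hx0 rfl
      have hy1 := hy0 rfl
      rw [chordalPow_none_none, chordalPow_none_none, chordalPow, if_pos rfl, ← normPow_inv,
        ← normPow_inv, normPow_sub_comm, ← normPow_mul, ← normPow_mul]
      congr 1
      simp only [chart]
      field_simp
    | some b =>
      rw [normPow_chart_none_sub_chart_some t b hx (hx0 rfl) hy, chordalPow_none_none,
        chordalPow_none_some, chordalPow_none_some, mul_one, mul_one]
  | some a =>
    cases d with
    | none =>
      rw [normPow_sub_comm, normPow_chart_none_sub_chart_some t a hy (hy0 rfl) hx,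
        chordalPow_none_none, chordalPow_none_some, chordalPow, if_neg (Option.some_ne_none a),
        one_mul, mul_one]
    | some b =>
      rw [chordalPow_none_some, chordalPow_none_some, one_mul, one_mul, chordalPow]
      split_ifs with hab
      · rw [hab, chart_some_sub]
      · exact normPow_eq_one (norm_chart_some_sub_of_ne (fun h => hab (congrArg some h)) hx hy) _

lemma normPow_natCast_sub_chart (t : ℝ) (a : Fin p) {c : Option (Fin p)} {y : ℚ_[p]}
    (hy : ‖y‖ ≤ 1) (hy0 : c = none → y ≠ 0) : normPow t ((a : ℕ) - chart c y) =
      chordalPow (-t) none c 0 y * chordalPow t (some a) c 0 y := by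
  have h := normPow_chart_sub t (c := some a) (x := 0) (by simp) hy (by simp) hy0
  rwa [chordalPow_none_some, one_mul, chart, mul_zero, add_zero] at h

end ChordalPow

section PointGraph

variable {N : ℕ}

/-- The pairs that contain `i`. -/
def pairsAt (i : T N) : Finset (Pair N) := {e | e.1.1 = i ∨ e.1.2 = i}

@[to_additive]
lemma prod_pair_eq_prod_pairsAt {M : Type*} [CommMonoid M] (f : T N → Pair N → M) :
    ∏ e : Pair N, f e.1.1 e * f e.1.2 e = ∏ i, ∏ e ∈ pairsAt i, f i e := by
  simp_rw [pairsAt, Finset.prod_filter]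
  rw [Finset.prod_comm]
  refine Finset.prod_congr rfl fun e _ => ?_
  rw [← Finset.prod_filter, ← Finset.prod_pair (f := fun i => f i e) e.2.ne]
  refine Finset.prod_congr ?_ fun _ _ => rfl
  ext i
  simp [eq_comm]

/-- The complete graph on the points `x_i` and on the marked points `0`, `1`, `∞` (in this order),
without the edges between the marked points. -/
def pointGraph (N : ℕ) : MarkedGraph (T N ⊕ Fin 3) (Fin 3 × T N ⊕ Pair N) where
  src := Sum.elim (fun mi => Sum.inr mi.1) fun e => Sum.inl e.1.1
  dst := Sum.elim (fun mi => Sum.inl mi.2) fun e => Sum.inl e.1.2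
  ne
    | Sum.inl _ => by simp
    | Sum.inr e => by simpa using e.2.ne
  marks := Finset.univ.map Function.Embedding.inr

/-- The exponent of the chordal distance of `x_i` from the `m`-th marked point. The one at infinity
collects the contributions of all factors of the integrand that involve `x_i` and of the Haar
measure. -/
noncomputable def markExponent (σ : Var N → ℝ) : Fin 3 → T N → ℝ
  | 0, i => σ (Var.first i)
  | 1, i => σ (Var.last i)
  | 2, i => -(2 + (σ (Var.first i) + σ (Var.last i) + ∑ e ∈ pairsAt i, σ (Var.pair e)))

/-- The exponents on the edges of `pointGraph`. -/
noncomputable def exponent (σ : Var N → ℝ) : Fin 3 × T N ⊕ Pair N → ℝ :=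
  Sum.elim (fun mi => markExponent σ mi.1 mi.2) fun e => σ (Var.pair e)

variable {p : ℕ} [hp : Fact p.Prime]

/-- The factor of the integrand with the exponent `s_v`. -/
noncomputable def factor (x : T N → ℚ_[p]) : Var N → ℚ_[p]
  | Sum.inl i => x i
  | Sum.inr (Sum.inl i) => 1 - x i
  | Sum.inr (Sum.inr e) => x e.1.1 - x e.1.2

@[fun_prop]
lemma measurable_factor (v : Var N) : Measurable fun x : T N → ℚ_[p] => factor x v := by
  rcases v with i | i | e <;> unfold factor <;> fun_prop

variable (p) in
/-- The absolute value of the integrand, extended by `0` to the divisor. -/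
noncomputable def absIntegrand (σ : Var N → ℝ) (x : T N → ℚ_[p]) : ℝ≥0∞ :=
  ∏ v, normPow (σ v) (factor x v)

lemma measurable_absIntegrand (σ : Var N → ℝ) : Measurable (absIntegrand p σ) := by
  unfold absIntegrand
  fun_prop

variable (p) in
/-- The residue discs of the marked points `0`, `1`, `∞`. -/
def markClass : Fin 3 → Option (Fin p) := ![some ⟨0, hp.1.pos⟩, some ⟨1, hp.1.one_lt⟩, none]

lemma absIntegrand_chart (σ : Var N → ℝ) {c : T N → Option (Fin p)} {y : T N → ℚ_[p]}
    (hy : ∀ i, ‖y i‖ ≤ 1) (hy0 : ∀ i, c i = none → y i ≠ 0) :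
    absIntegrand p σ (fun i => chart (c i) (y i)) =
      (∏ i, chordalPow (markExponent σ 2 i + 2) none (c i) 0 (y i)) *
        ((∏ i, chordalPow (σ (Var.first i)) (markClass p 0) (c i) 0 (y i)) *
        (∏ i, chordalPow (σ (Var.last i)) (markClass p 1) (c i) 0 (y i)) *
        ∏ e : Pair N, chordalPow (σ (Var.pair e)) (c e.1.1) (c e.1.2) (y e.1.1) (y e.1.2)) := by
  have first (i : T N) : normPow (σ (Var.first i)) (chart (c i) (y i)) =
      chordalPow (-σ (Var.first i)) none (c i) 0 (y i) *
        chordalPow (σ (Var.first i)) (markClass p 0) (c i) 0 (y i) := by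
    have h := normPow_natCast_sub_chart (σ (Var.first i)) ⟨0, hp.1.pos⟩ (hy i) (hy0 i)
    rw [Nat.cast_zero, zero_sub, normPow_neg] at h
    exact h
  have last (i : T N) : normPow (σ (Var.last i)) (1 - chart (c i) (y i)) =
      chordalPow (-σ (Var.last i)) none (c i) 0 (y i) *
        chordalPow (σ (Var.last i)) (markClass p 1) (c i) 0 (y i) := by
    have h := normPow_natCast_sub_chart (σ (Var.last i)) ⟨1, hp.1.one_lt⟩ (hy i) (hy0 i)
    rw [Nat.cast_one] at h
    exact h
  have at_infinity (i : T N) : chordalPow (markExponent σ 2 i + 2) none (c i) 0 (y i) =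
      chordalPow (-σ (Var.first i)) none (c i) 0 (y i) *
        chordalPow (-σ (Var.last i)) none (c i) 0 (y i) *
        ∏ e ∈ pairsAt i, chordalPow (-σ (Var.pair e)) none (c i) 0 (y i) := by
    rw [← chordalPow_sum _ _ fun h => (hy0 i h.symm).symm, ← chordalPow_add, ← chordalPow_add,
      markExponent, Finset.sum_neg_distrib]
    congr 1
    ring
  simp_rw [at_infinity]
  rw [Finset.prod_mul_distrib, Finset.prod_mul_distrib, ← prod_pair_eq_prod_pairsAt fun i e =>
    chordalPow (-σ (Var.pair e)) none (c i) 0 (y i)]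
  simp only [absIntegrand, Fintype.prod_sum_type, factor, first, last,
    normPow_chart_sub _ (hy _) (hy _) (hy0 _) (hy0 _), Finset.prod_mul_distrib]
  ring

lemma absIntegrand_chart_mul_prod_chartDensity (σ : Var N → ℝ) (c : T N → Option (Fin p))
    {y : T N ⊕ Fin 3 → ℚ_[p]} (hy : ∀ i, ‖y i‖ ≤ 1) (hy0 : ∀ m, y (Sum.inr m) = 0) :
    absIntegrand p σ (fun i => chart (c i) (y (Sum.inl i))) *
        ∏ i, chartDensity (c i) (y (Sum.inl i)) =
      (p : ℝ≥0∞)⁻¹ ^ Fintype.card (T N) *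
        ∏ a, ((pointGraph N).scale p (exponent σ) {i | Sum.elim c (markClass p) i = a} *
          (pointGraph N).edgeProd (exponent σ) {i | Sum.elim c (markClass p) i = a} y) := by
  have edges_univ : (pointGraph N).edges Finset.univ = Finset.univ := by
    simp [MarkedGraph.edges]
  have prod_edges : ∏ a, ((pointGraph N).scale p (exponent σ) {i | Sum.elim c (markClass p) i = a} *
        (pointGraph N).edgeProd (exponent σ) {i | Sum.elim c (markClass p) i = a} y) =
      (∏ m, ∏ i, chordalPow (markExponent σ m i) (markClass p m) (c i) 0 (y (Sum.inl i))) *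
        ∏ e : Pair N, chordalPow (σ (Var.pair e)) (c e.1.1) (c e.1.2) (y (Sum.inl e.1.1))
          (y (Sum.inl e.1.2)) := by
    rw [← MarkedGraph.prod_edges_ite_eq_prod_blocks, edges_univ, Fintype.prod_sum_type,
      Fintype.prod_prod_type]
    simp only [pointGraph, exponent, Sum.elim_inl, Sum.elim_inr, hy0, chordalPow]
    rfl
  rw [prod_edges, Fin.prod_univ_three]
  by_cases hdeg : ∃ i, c i = none ∧ y (Sum.inl i) = 0
  · obtain ⟨i, hi, hi0⟩ := hdeg
    have density_zero : chartDensity (c i) (y (Sum.inl i)) = 0 := by simp [hi, hi0, chartDensity]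
    have chordal_zero :
        ∏ i, chordalPow (markExponent σ 2 i) (markClass p 2) (c i) 0 (y (Sum.inl i)) = 0 :=
      Finset.prod_eq_zero (Finset.mem_univ i) (by simp [markClass, chordalPow, hi, hi0])
    rw [Finset.prod_eq_zero (Finset.mem_univ i) density_zero, chordal_zero, mul_zero, mul_zero,
      zero_mul, mul_zero]
  push Not at hdeg
  have infinity_mul (i : T N) :
      chordalPow (markExponent σ 2 i) (markClass p 2) (c i) 0 (y (Sum.inl i)) =
      chordalPow (markExponent σ 2 i + 2) none (c i) 0 (y (Sum.inl i)) *
        chordalPow (-2) none (c i) 0 (y (Sum.inl i)) := by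
    rw [← chordalPow_add, add_neg_cancel_right]
    rfl
  simp_rw [absIntegrand_chart σ (fun i => hy (Sum.inl i)) hdeg, chartDensity_eq, infinity_mul,
    Finset.prod_mul_distrib, Finset.prod_const, Finset.card_univ]
  simp only [markExponent]
  ring

lemma map_inl_measure : ((pointGraph N).measure p).map (fun y i => y (Sum.inl i)) =
    Measure.pi fun _ : T N => unitHaar p := by
  refine (Measure.pi_eq fun s hs => ?_).symm
  have preimage_box : (fun (y : T N ⊕ Fin 3 → ℚ_[p]) i => y (Sum.inl i)) ⁻¹' Set.univ.pi s =
      Set.univ.pi (Sum.elim s fun _ => Set.univ) := by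
    ext y
    simp [Set.mem_pi]
  rw [Measure.map_apply (by fun_prop) (MeasurableSet.univ_pi hs), preimage_box,
    MarkedGraph.measure, Measure.pi_pi, Fintype.prod_sum_type]
  simp [MarkedGraph.pointMeasure, pointGraph]

lemma ae_mark_eq_zero : ∀ᵐ y ∂(pointGraph N).measure p, ∀ m, y (Sum.inr m) = 0 := by
  refine ae_all_iff.2 fun m => ?_
  have h : ∀ᵐ x ∂(pointGraph N).pointMeasure p (Sum.inr m), x = 0 := by
    rw [MarkedGraph.pointMeasure, if_pos (by simp [pointGraph]), ae_dirac_eq]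
    exact eventually_pure.2 rfl
  exact (measurePreserving_eval ((pointGraph N).pointMeasure p)
    (Sum.inr m)).quasiMeasurePreserving.ae h

lemma lintegral_absIntegrand_chart (σ : Var N → ℝ) (c : T N → Option (Fin p)) :
    ∫⁻ y, absIntegrand p σ (fun i => chart (c i) (y i)) * ∏ i, chartDensity (c i) (y i)
        ∂Measure.pi (fun _ : T N => unitHaar p) =
      (p : ℝ≥0∞)⁻¹ ^ Fintype.card (T N) *
        ∏ a, ((pointGraph N).scale p (exponent σ) {i | Sum.elim c (markClass p) i = a} *
          (pointGraph N).mean p (exponent σ) {i | Sum.elim c (markClass p) i = a}) := by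
  have hF := measurable_absIntegrand (p := p) σ
  rw [← MarkedGraph.lintegral_prod_blocks, ← map_inl_measure,
    lintegral_map (by fun_prop) (by fun_prop),
    ← lintegral_const_mul _ (Finset.measurable_fun_prod _ fun a _ =>
      ((pointGraph N).measurable_edgeProd _ _).const_mul _)]
  refine lintegral_congr_ae ?_
  filter_upwards [(pointGraph N).ae_measure_norm_le_one, ae_mark_eq_zero] with y hy hy0
  exact absIntegrand_chart_mul_prod_chartDensity σ c hy hy0

lemma lintegral_absIntegrand (σ : Var N → ℝ) :
    ∫⁻ x, absIntegrand p σ x ∂haar p N = ∑ c : T N → Option (Fin p),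
      (p : ℝ≥0∞)⁻¹ ^ Fintype.card (T N) *
        ∏ a, ((pointGraph N).scale p (exponent σ) {i | Sum.elim c (markClass p) i = a} *
          (pointGraph N).mean p (exponent σ) {i | Sum.elim c (markClass p) i = a}) := by
  simp_rw [← lintegral_absIntegrand_chart]
  exact lintegral_pi_eq_sum (ν := fun _ : T N => unitHaar p) (φ := chart)
    (d := fun _ => chartDensity) measurable_chart (fun _ => measurable_chartDensity)
    (fun _ h hh => lintegral_padicHaar hh) (measurable_absIntegrand σ)

end PointGraph

/-! ## The affine forms of C1-C6 and the region of convergence -/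

section FacetForms

variable {N : ℕ}

/-- The affine form attached to the collision of the points `x_i`, `i ∈ J`, with the `m`-th marked
point. -/
noncomputable def markForm (m : Fin 3) (J : Finset (T N)) (σ : Var N → ℝ) : ℝ :=
  (J.card : ℝ) + ∑ i ∈ J, markExponent σ m i
    + ∑ e : Pair N with e.1.1 ∈ J ∧ e.1.2 ∈ J, σ (Var.pair e)

lemma markForm_zero (J : Finset (T N)) : markForm 0 J = formC4First J := rfl

lemma markForm_one (J : Finset (T N)) : markForm 1 J = formC4Last J := rfl

lemma markForm_two (J : Finset (T N)) (σ : Var N → ℝ) : markForm 2 J σ = -formC1 J σ := by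
  have sum_pairsAt : ∑ i ∈ J, ∑ e ∈ pairsAt i, σ (Var.pair e) =
      ∑ e : Pair N with e.1.1 ∈ J, σ (Var.pair e)
        + ∑ e : Pair N with e.1.1 ∉ J ∧ e.1.2 ∈ J, σ (Var.pair e)
        + ∑ e : Pair N with e.1.1 ∈ J ∧ e.1.2 ∈ J, σ (Var.pair e) := by
    have h := sum_pair_eq_sum_pairsAt fun i (e : Pair N) => if i ∈ J then σ (Var.pair e) else 0
    simp only [Finset.sum_ite_irrel, Finset.sum_const_zero, Finset.sum_ite_mem,
      Finset.univ_inter] at h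
    rw [← h, Finset.sum_filter, Finset.sum_filter, Finset.sum_filter, ← Finset.sum_add_distrib,
      ← Finset.sum_add_distrib]
    refine Finset.sum_congr rfl fun e _ => ?_
    by_cases h1 : e.1.1 ∈ J <;> by_cases h2 : e.1.2 ∈ J <;> simp [h1, h2]
  simp only [markForm, formC1, markExponent, Finset.sum_neg_distrib, Finset.sum_add_distrib,
    Finset.sum_const, nsmul_eq_mul, sum_pairsAt]
  ring

variable (N) in
/-- The affine forms of the conditions C1-C6, that of C1 with the opposite sign. -/
def facetForms : Set ((Var N → ℝ) → ℝ) :=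
  (⋃ (m : Fin 3) (J : Finset (T N)) (_ : J.Nonempty), {markForm m J}) ∪
  (⋃ (K : Finset (T N)) (_ : 2 ≤ K.card), {formC2 K}) ∪
  Set.range formC6

lemma finite_facetForms : (facetForms N).Finite :=
  Set.Finite.union (Set.toFinite _) (Set.finite_range _)

lemma markForm_mem_facetForms (m : Fin 3) {J : Finset (T N)} (hJ : J.Nonempty) :
    markForm m J ∈ facetForms N :=
  Or.inl (Or.inl (Set.mem_iUnion₂.2 ⟨m, J, Set.mem_iUnion.2 ⟨hJ, rfl⟩⟩))

lemma formC2_mem_facetForms {K : Finset (T N)} (hK : 2 ≤ K.card) : formC2 K ∈ facetForms N :=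
  Or.inl (Or.inr (Set.mem_iUnion₂.2 ⟨K, hK, rfl⟩))

variable (N) in
/-- The solution set of the conditions C1-C6 in `ℝ^D`. -/
def realRegion : Set (Var N → ℝ) := {σ | ∀ f ∈ facetForms N, 0 < f σ}

lemma forall_mem_facetForms_iff (P : ℝ → Prop) (σ : Var N → ℝ) :
    (∀ f ∈ facetForms N, P (f σ)) ↔
      (∀ J : Finset (T N), J.Nonempty → P (-formC1 J σ)) ∧
      (∀ K : Finset (T N), 2 ≤ K.card → P (formC2 K σ)) ∧
      (∀ J : Finset (T N), J.Nonempty → P (formC4First J σ)) ∧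
      (∀ J : Finset (T N), J.Nonempty → P (formC4Last J σ)) ∧
      (∀ v, P (formC6 v σ)) := by
  simp only [← markForm_two, ← markForm_zero, ← markForm_one]
  constructor
  · exact fun h => ⟨fun J hJ => h _ (markForm_mem_facetForms 2 hJ),
      fun K hK => h _ (formC2_mem_facetForms hK), fun J hJ => h _ (markForm_mem_facetForms 0 hJ),
      fun J hJ => h _ (markForm_mem_facetForms 1 hJ), fun v => h _ (Or.inr ⟨v, rfl⟩)⟩
  · rintro ⟨h1, h2, h3, h4, h5⟩ f ((hf | hf) | ⟨v, rfl⟩)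
    · simp only [Set.mem_iUnion, Set.mem_singleton_iff] at hf
      obtain ⟨m, J, hJ, rfl⟩ := hf
      fin_cases m
      exacts [h3 J hJ, h4 J hJ, h1 J hJ]
    · simp only [Set.mem_iUnion, Set.mem_singleton_iff] at hf
      obtain ⟨K, hK, rfl⟩ := hf
      exact h2 K hK
    · exact h5 v

lemma rePart_mem_realRegion {s : Var N → ℂ} : rePart s ∈ realRegion N ↔ s ∈ H N := by
  rw [realRegion, Set.mem_ofPred_eq, forall_mem_facetForms_iff]
  simp only [neg_pos]
  rfl

lemma mem_hyperplanes_iff {σ : Var N → ℝ} :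
    σ ∈ hyperplanes N ↔ ∃ f ∈ facetForms N, f σ = 0 := by
  rw [← not_iff_not]
  push Not
  rw [forall_mem_facetForms_iff (· ≠ 0)]
  simp [hyperplanes, and_assoc]

lemma rePart_notMem_hyperplanes {s : Var N → ℂ} (hs : s ∈ H N) :
    rePart s ∉ hyperplanes N := fun h =>
  have ⟨f, hf, hf0⟩ := mem_hyperplanes_iff.1 h
  (rePart_mem_realRegion.2 hs f hf).ne' hf0

end FacetForms

section IntegralAffine

variable (ι : Type*)

/-- The affine forms on `ℝ^ι` with integral coefficients. -/
def integralAffine : AddSubgroup ((ι → ℝ) → ℝ) :=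
  AddSubgroup.closure (insert 1 (Set.range fun i σ => σ i))

variable {ι}

lemma one_mem_integralAffine : (fun _ => 1) ∈ integralAffine ι :=
  AddSubgroup.subset_closure (Set.mem_insert _ _)

lemma coord_mem_integralAffine (i : ι) : (fun σ => σ i) ∈ integralAffine ι :=
  AddSubgroup.subset_closure (Set.mem_insert_of_mem _ ⟨i, rfl⟩)

lemma natCast_mem_integralAffine (n : ℕ) : (fun _ => (n : ℝ)) ∈ integralAffine ι := by
  convert nsmul_mem (one_mem_integralAffine (ι := ι)) n using 1
  ext
  simp

lemma sum_mem_integralAffine {α : Type*} {s : Finset α} {f : α → (ι → ℝ) → ℝ}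
    (hf : ∀ a ∈ s, f a ∈ integralAffine ι) : (fun σ => ∑ a ∈ s, f a σ) ∈ integralAffine ι := by
  rw [← Finset.sum_fn]
  exact sum_mem hf

lemma continuous_of_mem_integralAffine {f : (ι → ℝ) → ℝ} (hf : f ∈ integralAffine ι) :
    Continuous f := by
  induction hf using AddSubgroup.closure_induction with
  | mem f hf =>
    obtain rfl | ⟨i, rfl⟩ := hf
    exacts [continuous_const, continuous_apply i]
  | zero => exact continuous_const
  | add f g _ _ hf hg => exact hf.add hg
  | neg f _ hf => exact hf.neg

lemma map_add_of_mem_integralAffine {f : (ι → ℝ) → ℝ} (hf : f ∈ integralAffine ι) {a b : ℝ}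
    (hab : a + b = 1) (σ τ : ι → ℝ) : f (a • σ + b • τ) = a * f σ + b * f τ := by
  induction hf using AddSubgroup.closure_induction with
  | mem f hf =>
    obtain rfl | ⟨i, rfl⟩ := hf
    · simp [hab]
    · simp
  | zero => simp
  | add f g _ _ hf hg => simp only [Pi.add_apply, hf, hg]; ring
  | neg f _ hf => simp only [Pi.neg_apply, hf]; ring

variable {N : ℕ}

lemma markExponent_mem_integralAffine (m : Fin 3) (i : T N) :
    (fun σ => markExponent σ m i) ∈ integralAffine (Var N) := by
  fin_cases m
  · exact coord_mem_integralAffine _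
  · exact coord_mem_integralAffine _
  · exact neg_mem (add_mem (natCast_mem_integralAffine 2) (add_mem (add_mem
      (coord_mem_integralAffine _) (coord_mem_integralAffine _))
      (sum_mem_integralAffine fun e _ => coord_mem_integralAffine _)))

lemma facetForms_subset_integralAffine : facetForms N ⊆ integralAffine (Var N) := by
  rintro f ((hf | hf) | ⟨v, rfl⟩)
  · simp only [Set.mem_iUnion, Set.mem_singleton_iff] at hf
    obtain ⟨m, J, -, rfl⟩ := hf
    exact add_mem (add_mem (natCast_mem_integralAffine _)
      (sum_mem_integralAffine fun i _ => markExponent_mem_integralAffine m i))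
      (sum_mem_integralAffine fun e _ => coord_mem_integralAffine _)
  · simp only [Set.mem_iUnion, Set.mem_singleton_iff] at hf
    obtain ⟨K, -, rfl⟩ := hf
    exact add_mem (sub_mem (natCast_mem_integralAffine _) one_mem_integralAffine)
      (sum_mem_integralAffine fun e _ => coord_mem_integralAffine _)
  · exact add_mem one_mem_integralAffine (coord_mem_integralAffine v)

lemma exponent_mem_integralAffine (e : Fin 3 × T N ⊕ Pair N) :
    (fun σ => exponent σ e) ∈ integralAffine (Var N) := by
  rcases e with ⟨m, i⟩ | e
  · exact markExponent_mem_integralAffine m i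
  · exact coord_mem_integralAffine _

lemma isOpen_realRegion : IsOpen (realRegion N) := by
  have : realRegion N = ⋂ f ∈ facetForms N, {σ | 0 < f σ} := by
    ext σ
    simp [realRegion]
  rw [this]
  exact finite_facetForms.isOpen_biInter fun f hf => isOpen_lt continuous_const
    (continuous_of_mem_integralAffine (facetForms_subset_integralAffine hf))

lemma convex_realRegion : Convex ℝ (realRegion N) := by
  intro σ hσ τ hτ a b ha hb hab f hf
  rw [map_add_of_mem_integralAffine (facetForms_subset_integralAffine hf) hab]
  rcases ha.eq_or_lt with rfl | ha
  · simpa [(zero_add b).symm.trans hab] using hτ f hf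
  · exact add_pos_of_pos_of_nonneg (mul_pos ha (hσ f hf)) (mul_nonneg hb (hτ f hf).le)

lemma H_eq_preimage : H N = rePart ⁻¹' realRegion N :=
  Set.ext fun _ => rePart_mem_realRegion.symm

lemma continuous_rePart : Continuous (rePart (N := N)) :=
  continuous_pi fun v => Complex.continuous_re.comp (continuous_apply v)

lemma isOpen_H : IsOpen (H N) := by
  rw [H_eq_preimage]
  exact isOpen_realRegion.preimage continuous_rePart

lemma convex_H : Convex ℝ (H N) := by
  rw [H_eq_preimage]
  refine convex_realRegion.is_linear_preimage ⟨fun s t => ?_, fun c s => ?_⟩ <;>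
    ext v <;> simp [rePart]

lemma H_nonempty : (H N).Nonempty := by
  have card_pos {J : Finset (T N)} (hJ : J.Nonempty) : (0 : ℝ) < J.card :=
    Nat.cast_pos.2 hJ.card_pos
  refine ⟨Sum.elim (fun _ => -2 / 3) (Sum.elim (fun _ => -2 / 3) fun _ => 0), fun J hJ => ?_,
    fun K hK => ?_, fun J hJ => ?_, fun J hJ => ?_, ?_⟩
  · norm_num [formC1, rePart]
    linarith [card_pos hJ]
  · have : (2 : ℝ) ≤ K.card := by exact_mod_cast hK
    norm_num [formC2, rePart]
    linarith
  · norm_num [formC4First, rePart]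
    linarith [card_pos hJ]
  · norm_num [formC4Last, rePart]
    linarith [card_pos hJ]
  · rintro (i | i | e) <;> norm_num [formC6, rePart]

end IntegralAffine

/-! ## Rationality -/

section Rationality

lemma toReal_natCast_rpow (n : ℕ) (t : ℝ) : ((n : ℝ≥0∞) ^ t).toReal = (n : ℝ) ^ t := by
  rw [← ENNReal.toReal_rpow, ENNReal.toReal_natCast]

variable (p : ℕ) [hp : Fact p.Prime] {N : ℕ}

lemma rpow_eq_one_iff_eq_zero {t : ℝ} : (p : ℝ) ^ t = 1 ↔ t = 0 := by
  rw [← Real.rpow_right_inj (x := p) (y := t) (by exact_mod_cast hp.1.pos)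
    (by exact_mod_cast hp.1.ne_one), Real.rpow_zero]

variable (N) in
/-- The polynomials whose values at the points `(p^{-s})` vanish only over the hyperplanes. -/
noncomputable def denominators : Submonoid (MvPolynomial (Var N) ℚ) where
  carrier := {Q | ∀ s, evalPow p Q s = 0 → rePart s ∈ hyperplanes N}
  one_mem' := fun s h => by simp [evalPow] at h
  mul_mem' := fun {P Q} hP hQ s h => by
    rw [evalPow, map_mul, mul_eq_zero] at h
    exact h.elim (hP s) (hQ s)

variable (N) in
/-- The finite functions on the real points of `H(ℂ)` that are rational functions of the `p^{-σ}`
with a denominator in `denominators`. -/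
noncomputable def rationalFunctions : Subsemiring (realRegion N → ℝ≥0∞) where
  carrier := {f | (∀ σ, f σ ≠ ⊤) ∧ ∃ P, ∃ Q ∈ denominators p N, ∀ σ : realRegion N,
    ((f σ).toReal : ℂ) * evalPow p Q (fun v => σ.1 v) = evalPow p P (fun v => σ.1 v)}
  zero_mem' := ⟨by simp, 0, 1, one_mem _, by simp [evalPow]⟩
  one_mem' := ⟨by simp, 1, 1, one_mem _, by simp [evalPow]⟩
  add_mem' := by
    rintro f g ⟨hf, P, Q, hQ, hPQ⟩ ⟨hg, P', Q', hQ', hPQ'⟩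
    refine ⟨fun σ => ENNReal.add_ne_top.2 ⟨hf σ, hg σ⟩, P * Q' + P' * Q, Q * Q', mul_mem hQ hQ',
      fun σ => ?_⟩
    have h := hPQ σ
    have h' := hPQ' σ
    simp only [evalPow, map_mul, map_add, Pi.add_apply, ENNReal.toReal_add (hf σ) (hg σ),
      Complex.ofReal_add] at h h' ⊢
    rw [← h, ← h']
    ring
  mul_mem' := by
    rintro f g ⟨hf, P, Q, hQ, hPQ⟩ ⟨hg, P', Q', hQ', hPQ'⟩
    refine ⟨fun σ => ENNReal.mul_ne_top (hf σ) (hg σ), P * P', Q * Q', mul_mem hQ hQ',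
      fun σ => ?_⟩
    have h := hPQ σ
    have h' := hPQ' σ
    simp only [evalPow, map_mul, Pi.mul_apply, ENNReal.toReal_mul, Complex.ofReal_mul] at h h' ⊢
    rw [← h, ← h']
    ring

lemma exists_rpow_neg_eq_div {f : (Var N → ℝ) → ℝ} (hf : f ∈ integralAffine (Var N)) :
    ∃ A B : MvPolynomial (Var N) ℚ,
      (∀ s, evalPow p B s ≠ 0 ∧
        ‖evalPow p A s‖ = (p : ℝ) ^ (-f (rePart s)) * ‖evalPow p B s‖) ∧
      ∀ σ : Var N → ℝ, evalPow p A (fun v => σ v) =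
        ((p : ℝ) ^ (-f σ) : ℝ) * evalPow p B (fun v => σ v) := by
  have hp0 : (0 : ℝ) < p := by exact_mod_cast hp.1.pos
  induction hf using AddSubgroup.closure_induction with
  | mem f hf =>
    obtain rfl | ⟨v, rfl⟩ := hf
    · exact ⟨MvPolynomial.C (p : ℚ)⁻¹, 1, by simp [evalPow, Real.rpow_neg_one],
        by simp [evalPow, Real.rpow_neg_one]⟩
    · refine ⟨MvPolynomial.X v, 1, fun s => ⟨by simp [evalPow], ?_⟩, fun σ => ?_⟩
      · simp [evalPow, Complex.norm_natCast_cpow_of_pos hp.1.pos, rePart]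
      · simp [evalPow, Complex.ofReal_cpow hp0.le]
  | zero => exact ⟨1, 1, by simp [evalPow], by simp [evalPow]⟩
  | add f g _ _ hf hg =>
    obtain ⟨A, B, hAB, hAB_real⟩ := hf
    obtain ⟨A', B', hAB', hAB'_real⟩ := hg
    simp only [evalPow] at hAB hAB_real hAB' hAB'_real
    refine ⟨A * A', B * B', fun s => ?_, fun σ => ?_⟩
    · simp only [evalPow, map_mul, norm_mul, (hAB s).2, (hAB' s).2, Pi.add_apply, neg_add,
        Real.rpow_add hp0]
      exact ⟨mul_ne_zero (hAB s).1 (hAB' s).1, by ring⟩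
    · simp only [evalPow, map_mul, hAB_real, hAB'_real, Pi.add_apply, neg_add,
        Real.rpow_add hp0, Complex.ofReal_mul]
      ring
  | neg f _ hf =>
    obtain ⟨A, B, hAB, hAB_real⟩ := hf
    have hpos (t : ℝ) : (p : ℝ) ^ t ≠ 0 := (Real.rpow_pos_of_pos hp0 t).ne'
    refine ⟨B, A, fun s => ⟨?_, ?_⟩, fun σ => ?_⟩
    · rw [← norm_ne_zero_iff, (hAB s).2]
      exact mul_ne_zero (hpos _) (norm_ne_zero_iff.2 (hAB s).1)
    · rw [(hAB s).2, ← mul_assoc, ← Real.rpow_add hp0]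
      simp
    · rw [hAB_real σ, ← mul_assoc, ← Complex.ofReal_mul, ← Real.rpow_add hp0]
      simp

variable {p}

lemma rpow_neg_mem_rationalFunctions {f : (Var N → ℝ) → ℝ} (hf : f ∈ integralAffine (Var N)) :
    (fun σ : realRegion N => (p : ℝ≥0∞) ^ (-f σ.1)) ∈ rationalFunctions p N := by
  obtain ⟨A, B, hAB, hAB_real⟩ := exists_rpow_neg_eq_div p hf
  refine ⟨fun σ => ENNReal.rpow_ne_top_of_ne_zero (natCast_ennreal_ne_zero p)
    (ENNReal.natCast_ne_top p), A, B, fun s h => absurd h (hAB s).1, fun σ => ?_⟩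
  rw [toReal_natCast_rpow, hAB_real]

lemma inv_one_sub_rpow_neg_mem_rationalFunctions {f : (Var N → ℝ) → ℝ} (hf : f ∈ facetForms N) :
    (fun σ : realRegion N => (1 - (p : ℝ≥0∞) ^ (-f σ.1))⁻¹) ∈ rationalFunctions p N := by
  obtain ⟨A, B, hAB, hAB_real⟩ := exists_rpow_neg_eq_div p (facetForms_subset_integralAffine hf)
  have rpow_lt_one (σ : realRegion N) : (p : ℝ≥0∞) ^ (-f σ.1) < 1 :=
    ENNReal.rpow_lt_one_of_one_lt_of_neg (by exact_mod_cast hp.1.one_lt)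
      (neg_neg_of_pos (σ.2 f hf))
  refine ⟨fun σ => ENNReal.inv_ne_top.2 (tsub_pos_of_lt (rpow_lt_one σ)).ne', B, B - A,
    fun s h => mem_hyperplanes_iff.2 ⟨f, hf, ?_⟩, fun σ => ?_⟩
  · have norm_eq := (hAB s).2
    replace h : evalPow p B s = evalPow p A s := by rwa [evalPow, map_sub, sub_eq_zero] at h
    rw [← h, eq_comm, mul_eq_right₀ (norm_ne_zero_iff.2 (hAB s).1),
      rpow_eq_one_iff_eq_zero, neg_eq_zero] at norm_eq
    exact norm_eq
  · have hne : (1 : ℂ) - ((p : ℝ) ^ (-f σ.1) : ℝ) ≠ 0 := by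
      rw [sub_ne_zero, ne_eq, eq_comm, Complex.ofReal_eq_one, rpow_eq_one_iff_eq_zero, neg_eq_zero]
      exact (σ.2 f hf).ne'
    have eval_sub : evalPow p (B - A) (fun v => σ.1 v) =
        (1 - ((p : ℝ) ^ (-f σ.1) : ℝ)) * evalPow p B (fun v => σ.1 v) := by
      rw [sub_mul, one_mul, ← hAB_real]
      exact map_sub _ _ _
    rw [ENNReal.toReal_inv, ENNReal.toReal_sub_of_le (rpow_lt_one σ).le ENNReal.one_ne_top,
      toReal_natCast_rpow, ENNReal.toReal_one, eval_sub, Complex.ofReal_inv, Complex.ofReal_sub,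
      Complex.ofReal_one, inv_mul_cancel_left₀ hne]

end Rationality

section Blocks

variable {N : ℕ}

lemma edges_pointGraph (K : Finset (T N ⊕ Fin 3)) : (pointGraph N).edges K =
    (K.toRight ×ˢ K.toLeft).disjSum {e | e.1.1 ∈ K.toLeft ∧ e.1.2 ∈ K.toLeft} := by
  ext e
  rw [MarkedGraph.edges, Finset.mem_filter_univ]
  rcases e with mi | e <;> simp [pointGraph]

lemma admissible_pointGraph {B : Finset (T N ⊕ Fin 3)} (hB : B.toRight.card ≤ 1) :
    (pointGraph N).Admissible B := by
  have mark_eq : ∀ m m', Sum.inr m ∈ B → Sum.inr m' ∈ B → m = m' := fun m m' h h' =>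
    Finset.card_le_one.1 hB m (Finset.mem_toRight.2 h) m' (Finset.mem_toRight.2 h')
  refine ⟨Finset.card_le_one.2 ?_, fun K hK hK2 => ?_⟩
  · rintro (i | m) hx (j | m') hy
    · simp [pointGraph] at hx
    · simp [pointGraph] at hx
    · simp [pointGraph] at hy
    · rw [mark_eq m m' (Finset.mem_inter.1 hx).1 (Finset.mem_inter.1 hy).1]
  · obtain ⟨x, hx, y, hy, hxy⟩ := Finset.one_lt_card.1 hK2
    have edge {u v} (hu : u ∈ K) (hv : v ∈ K) (e) (he : (pointGraph N).src e = u)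
        (he' : (pointGraph N).dst e = v) : ((pointGraph N).edges K).Nonempty :=
      ⟨e, Finset.mem_filter.2 ⟨Finset.mem_univ e, he ▸ hu, he' ▸ hv⟩⟩
    rcases x with i | m <;> rcases y with j | m'
    · rcases lt_or_gt_of_ne (fun h => hxy (congrArg Sum.inl h) : i ≠ j) with h | h
      · exact edge hx hy (Sum.inr ⟨(i, j), h⟩) rfl rfl
      · exact edge hy hx (Sum.inr ⟨(j, i), h⟩) rfl rfl
    · exact edge hy hx (Sum.inl (m', i)) rfl rfl
    · exact edge hx hy (Sum.inl (m, j)) rfl rfl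
    · exact absurd (congrArg Sum.inr (mark_eq m m' (hK hx) (hK hy))) hxy

/-- The ratio of the geometric series attached to a block is governed by one of the forms C1-C6. -/
lemma exists_facetForm_eq {K : Finset (T N ⊕ Fin 3)} (hK : K.toRight.card ≤ 1)
    (hK2 : 2 ≤ K.card) : ∃ f ∈ facetForms N, ∀ σ,
      1 - (K.card : ℝ) - ∑ e ∈ (pointGraph N).edges K, exponent σ e = -f σ := by
  have hcard := K.card_toLeft_add_card_toRight
  simp_rw [edges_pointGraph, Finset.sum_disjSum, Finset.sum_product, exponent, Sum.elim_inl,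
    Sum.elim_inr]
  rcases Finset.card_le_one_iff_subset_singleton.1 hK with ⟨m, hm⟩
  rcases Finset.subset_singleton_iff.1 hm with hm | hm <;> rw [hm] at hcard ⊢
  · rw [Finset.card_empty, add_zero] at hcard
    refine ⟨formC2 K.toLeft, formC2_mem_facetForms (hcard ▸ hK2), fun σ => ?_⟩
    rw [formC2, hcard, Finset.sum_empty]
    ring
  · rw [Finset.card_singleton] at hcard
    refine ⟨markForm m K.toLeft, markForm_mem_facetForms m (Finset.card_pos.1 (by lia)),
      fun σ => ?_⟩
    rw [markForm, ← hcard, Finset.sum_singleton, Nat.cast_add, Nat.cast_one]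
    ring

variable {p : ℕ} [hp : Fact p.Prime]

lemma injective_markClass : Function.Injective (markClass p) := by
  intro m m' h
  fin_cases m <;> fin_cases m' <;> simp [markClass] at h ⊢

lemma card_toRight_block (c : T N → Option (Fin p)) (a : Option (Fin p)) :
    (Finset.toRight ({i | Sum.elim c (markClass p) i = a} : Finset (T N ⊕ Fin 3))).card ≤ 1 := by
  refine Finset.card_le_one.2 fun m hm m' hm' => injective_markClass (p := p) ?_
  simp only [Finset.mem_toRight, Finset.mem_filter_univ, Sum.elim_inr] at hm hm'
  exact hm.trans hm'.symm

lemma scale_mem_rationalFunctions (K : Finset (T N ⊕ Fin 3)) :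
    (fun σ : realRegion N => (pointGraph N).scale p (exponent σ.1) K) ∈ rationalFunctions p N :=
  rpow_neg_mem_rationalFunctions (f := fun σ => ∑ e ∈ (pointGraph N).edges K, exponent σ e)
    (sum_mem_integralAffine fun e _ => exponent_mem_integralAffine e)

lemma inv_one_sub_ratio_mem_rationalFunctions {K : Finset (T N ⊕ Fin 3)}
    (hK : K.toRight.card ≤ 1) (hK2 : 2 ≤ K.card) :
    (fun σ : realRegion N => (1 - (pointGraph N).ratio p (exponent σ.1) K)⁻¹) ∈
      rationalFunctions p N := by
  obtain ⟨f, hf, hfK⟩ := exists_facetForm_eq hK hK2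
  simp_rw [MarkedGraph.ratio, hfK]
  exact inv_one_sub_rpow_neg_mem_rationalFunctions hf

lemma lintegral_absIntegrand_mem_rationalFunctions :
    (fun σ : realRegion N => ∫⁻ x, absIntegrand p σ.1 x ∂haar p N) ∈ rationalFunctions p N := by
  have inv_p_mem : (fun _ : realRegion N => (p : ℝ≥0∞)⁻¹) ∈ rationalFunctions p N := by
    simpa only [ENNReal.rpow_neg_one] using
      rpow_neg_mem_rationalFunctions (p := p) (N := N) one_mem_integralAffine
  have block_mem (c : T N → Option (Fin p)) (a : Option (Fin p)) :
      (fun σ : realRegion N =>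
        (pointGraph N).mean p (exponent σ.1) {i | Sum.elim c (markClass p) i = a}) ∈
      rationalFunctions p N := by
    have hB := card_toRight_block c a
    refine MarkedGraph.mean_mem _ _ (fun σ : realRegion N => exponent σ.1) inv_p_mem
      (admissible_pointGraph hB) (fun K _ _ => scale_mem_rationalFunctions K)
      fun K hK hK2 => inv_one_sub_ratio_mem_rationalFunctions
        ((Finset.card_le_card (Finset.toRight_subset_toRight hK)).trans hB) hK2
  have fun_eq : (fun σ : realRegion N => ∫⁻ x, absIntegrand p σ.1 x ∂haar p N) =
      ∑ c : T N → Option (Fin p), (fun _ => (p : ℝ≥0∞)⁻¹) ^ Fintype.card (T N) * ∏ a,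
        ((fun σ : realRegion N =>
          (pointGraph N).scale p (exponent σ.1) {i | Sum.elim c (markClass p) i = a}) *
        fun σ : realRegion N =>
          (pointGraph N).mean p (exponent σ.1) {i | Sum.elim c (markClass p) i = a}) := by
    funext σ
    rw [lintegral_absIntegrand]
    simp only [Finset.sum_apply, Finset.prod_apply, Pi.mul_apply, Pi.pow_apply]
  rw [fun_eq]
  exact sum_mem fun c _ => mul_mem (pow_mem inv_p_mem _)
    (prod_mem fun a _ => mul_mem (scale_mem_rationalFunctions _) (block_mem c a))

end Blocks

/-! ## Holomorphy and continuation -/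

section Integrand

variable {p : ℕ} [hp : Fact p.Prime] {N : ℕ}

lemma mem_divisor_iff {x : T N → ℚ_[p]} : x ∈ divisor p N ↔ ∃ v, factor x v = 0 := by
  simp only [divisor, Set.mem_ofPred_eq, mul_eq_zero, Finset.prod_eq_zero_iff, Finset.mem_univ,
    true_and, Sum.exists, factor, exists_or, or_assoc]

lemma measurableSet_divisor : MeasurableSet (divisor p N) := by
  have divisor_eq : divisor p N = ⋃ v, {x | factor x v = 0} := by
    ext x
    simp only [mem_divisor_iff, Set.mem_iUnion, Set.mem_ofPred_eq]
  rw [divisor_eq]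
  exact MeasurableSet.iUnion fun v => measurable_factor v (measurableSet_singleton 0)

lemma integrand_eq_prod (s : Var N → ℂ) (x : T N → ℚ_[p]) :
    integrand p N s x = ∏ v, ((‖factor x v‖ : ℝ) : ℂ) ^ s v := by
  rw [Fintype.prod_sum_type, Fintype.prod_sum_type, ← mul_assoc, ← Finset.prod_mul_distrib]
  rfl

lemma measurable_integrand (s : Var N → ℂ) : Measurable (integrand p N s) := by
  simp only [funext (integrand_eq_prod (p := p) s)]
  fun_prop

lemma absIntegrand_of_mem {σ : Var N → ℝ} {x : T N → ℚ_[p]} (hx : x ∈ divisor p N) :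
    absIntegrand p σ x = 0 := by
  obtain ⟨v, hv⟩ := mem_divisor_iff.1 hx
  exact Finset.prod_eq_zero (Finset.mem_univ v) (if_pos hv)

lemma absIntegrand_lt_top (σ : Var N → ℝ) (x : T N → ℚ_[p]) : absIntegrand p σ x < ⊤ :=
  ENNReal.prod_lt_top fun _ _ => (normPow_ne_top _ _).lt_top

lemma toReal_absIntegrand (σ : Var N → ℝ) {x : T N → ℚ_[p]} (hx : x ∉ divisor p N) :
    (absIntegrand p σ x).toReal = ∏ v, ‖factor x v‖ ^ σ v := by
  rw [mem_divisor_iff, not_exists] at hx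
  simp only [absIntegrand, ENNReal.toReal_prod, toReal_normPow (hx _)]

lemma enorm_integrand {s : Var N → ℂ} {x : T N → ℚ_[p]} (hx : x ∉ divisor p N) :
    ‖integrand p N s x‖ₑ = absIntegrand p (rePart s) x := by
  have factor_pos (v : Var N) : 0 < ‖factor x v‖ :=
    norm_pos_iff.2 fun h => hx (mem_divisor_iff.2 ⟨v, h⟩)
  rw [← ENNReal.toReal_eq_toReal_iff' enorm_ne_top (absIntegrand_lt_top _ _).ne, toReal_enorm,
    toReal_absIntegrand _ hx, integrand_eq_prod, norm_prod]
  simp only [Complex.norm_cpow_eq_rpow_re_of_pos (factor_pos _), rePart]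

lemma setLIntegral_absIntegrand (σ : Var N → ℝ) :
    ∫⁻ x in (divisor p N)ᶜ, absIntegrand p σ x ∂haar p N = ∫⁻ x, absIntegrand p σ x ∂haar p N :=
  setLIntegral_eq_of_support_subset fun _ hx => mt absIntegrand_of_mem hx

lemma lintegral_enorm_integrand (s : Var N → ℂ) :
    ∫⁻ x in (divisor p N)ᶜ, ‖integrand p N s x‖ₑ ∂haar p N =
      ∫⁻ x, absIntegrand p (rePart s) x ∂haar p N := by
  rw [← setLIntegral_absIntegrand]
  exact setLIntegral_congr_fun measurableSet_divisor.compl fun _ hx => enorm_integrand hx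

lemma integrableOn_integrand {s : Var N → ℂ} (hs : s ∈ H N) :
    IntegrableOn (integrand p N s) (divisor p N)ᶜ (haar p N) := by
  refine ⟨(measurable_integrand s).aestronglyMeasurable, ?_⟩
  rw [HasFiniteIntegral, lintegral_enorm_integrand]
  exact (lintegral_absIntegrand_mem_rationalFunctions.1 ⟨_, rePart_mem_realRegion.2 hs⟩).lt_top

end Integrand

section ComplexLine

variable {N : ℕ} {σ τ : Var N → ℝ}

/-- The complex line through the real point `σ` in the real direction `τ`. -/
def complexLine (σ τ : Var N → ℝ) (z : ℂ) : Var N → ℂ := fun v => σ v + z * τ v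

lemma differentiable_complexLine : Differentiable ℂ (complexLine σ τ) := by
  unfold complexLine
  fun_prop

lemma complexLine_I (s : Var N → ℂ) :
    complexLine (rePart s) (fun v => (s v).im) Complex.I = s := by
  funext v
  rw [complexLine, mul_comm]
  exact Complex.re_add_im (s v)

lemma complexLine_zero : complexLine σ τ 0 = fun v => (σ v : ℂ) := by
  funext v
  simp [complexLine]

lemma complexLine_ofReal (t : ℝ) : complexLine σ τ t = fun v => (((σ + t • τ) v : ℝ) : ℂ) := by
  funext v
  simp [complexLine]

lemma complexLine_mem_H_iff {z : ℂ} : complexLine σ τ z ∈ H N ↔ σ + z.re • τ ∈ realRegion N := by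
  have rePart_complexLine : rePart (complexLine σ τ z) = σ + z.re • τ := by
    funext v
    simp [rePart, complexLine]
  rw [← rePart_mem_realRegion, rePart_complexLine]

lemma convex_preimage_complexLine : Convex ℝ (complexLine σ τ ⁻¹' H N) := by
  have preimage_eq : complexLine σ τ ⁻¹' H N =
      Complex.reLm.smulRight τ ⁻¹' ((fun u => σ + u) ⁻¹' realRegion N) :=
    Set.ext fun _ => complexLine_mem_H_iff
  rw [preimage_eq]
  exact (convex_realRegion.translate_preimage_right σ).linear_preimage _

lemma isOpen_setOf_add_smul_mem_realRegion : IsOpen {t : ℝ | σ + t • τ ∈ realRegion N} :=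
  isOpen_realRegion.preimage (by fun_prop)

end ComplexLine

section Continuation

variable {p : ℕ} [hp : Fact p.Prime] {N : ℕ}

lemma analyticAt_evalPow (P : MvPolynomial (Var N) ℚ) (s : Var N → ℂ) :
    AnalyticAt ℂ (evalPow p P) s := by
  have p_ne_zero : (p : ℂ) ≠ 0 := by exact_mod_cast hp.1.ne_zero
  have analyticAt_pow (v : Var N) : AnalyticAt ℂ (fun s : Var N → ℂ => (p : ℂ) ^ (-s v)) s := by
    simp only [Complex.cpow_def_of_ne_zero p_ne_zero]
    exact (analyticAt_const.mul
      ((ContinuousLinearMap.proj (R := ℂ) (φ := fun _ : Var N => ℂ) v).analyticAt s).neg).cexp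
  exact AnalyticAt.aeval_mvPolynomial analyticAt_pow P

variable (p) in
/-- The logarithm of `absIntegrand p τ`. It is linear in `τ`, so that along a line the zeta integral
is the moment generating function of `logIntegrand`. -/
noncomputable def logIntegrand (τ : Var N → ℝ) (x : T N → ℚ_[p]) : ℝ :=
  ∑ v, τ v * Real.log ‖factor x v‖

lemma integrand_complexLine (σ τ : Var N → ℝ) (z : ℂ) {x : T N → ℚ_[p]} (hx : x ∉ divisor p N) :
    integrand p N (complexLine σ τ z) x =
      (absIntegrand p σ x).toReal • Complex.exp (z * logIntegrand p τ x) := by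
  rw [integrand_eq_prod, toReal_absIntegrand σ hx, logIntegrand, Complex.real_smul,
    Complex.ofReal_sum, Finset.mul_sum, Complex.exp_sum, Complex.ofReal_prod,
    ← Finset.prod_mul_distrib]
  refine Finset.prod_congr rfl fun v _ => ?_
  have factor_ne_zero : ((‖factor x v‖ : ℝ) : ℂ) ≠ 0 :=
    Complex.ofReal_ne_zero.2 (norm_ne_zero_iff.2 fun h => hx (mem_divisor_iff.2 ⟨v, h⟩))
  rw [complexLine, Complex.cpow_add _ _ factor_ne_zero, Complex.ofReal_cpow (norm_nonneg _),
    Complex.cpow_def_of_ne_zero factor_ne_zero (z * τ v), ← Complex.ofReal_log (norm_nonneg _),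
    Complex.ofReal_mul, mul_comm (Complex.ofReal (Real.log _)), mul_assoc]

variable (p) in
/-- The measure with density `absIntegrand p σ` on the complement of the divisor. -/
noncomputable def weightedHaar (σ : Var N → ℝ) : Measure (T N → ℚ_[p]) :=
  ((haar p N).restrict (divisor p N)ᶜ).withDensity (absIntegrand p σ)

lemma zeta_complexLine (σ τ : Var N → ℝ) (z : ℂ) :
    zeta p N (complexLine σ τ z) =
      ProbabilityTheory.complexMGF (logIntegrand p τ) (weightedHaar p σ) z := by
  rw [ProbabilityTheory.complexMGF, weightedHaar, integral_withDensity_eq_integral_toReal_smul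
    (measurable_absIntegrand σ) (Eventually.of_forall (absIntegrand_lt_top σ))]
  exact setIntegral_congr_fun measurableSet_divisor.compl fun x hx =>
    integrand_complexLine σ τ z hx

lemma zeta_ofReal (σ : Var N → ℝ) :
    zeta p N (fun v => (σ v : ℂ)) = ((∫⁻ x, absIntegrand p σ x ∂haar p N).toReal : ℂ) := by
  rw [← setLIntegral_absIntegrand, ← integral_toReal (measurable_absIntegrand σ).aemeasurable
    (Eventually.of_forall (absIntegrand_lt_top σ)), ← integral_complex_ofReal]
  refine setIntegral_congr_fun measurableSet_divisor.compl fun x hx => ?_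
  simpa [complexLine_zero] using integrand_complexLine σ 0 0 hx

lemma mem_integrableExpSet {σ τ : Var N → ℝ} {t : ℝ} (ht : σ + t • τ ∈ realRegion N) :
    t ∈ ProbabilityTheory.integrableExpSet (logIntegrand p τ) (weightedHaar p σ) := by
  have line_mem : complexLine σ τ t ∈ H N := complexLine_mem_H_iff.2 ht
  rw [ProbabilityTheory.integrableExpSet, Set.mem_ofPred_eq, weightedHaar,
    integrable_withDensity_iff_integrable_smul' (measurable_absIntegrand σ)
      (Eventually.of_forall (absIntegrand_lt_top σ))]
  refine (integrableOn_integrand line_mem).norm.congr ?_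
  filter_upwards [ae_restrict_mem measurableSet_divisor.compl] with x hx
  rw [integrand_complexLine σ τ t hx, norm_smul, Complex.norm_exp]
  simp

lemma differentiableOn_zeta_complexLine (σ τ : Var N → ℝ) :
    DifferentiableOn ℂ (fun z => zeta p N (complexLine σ τ z)) (complexLine σ τ ⁻¹' H N) := by
  simp only [zeta_complexLine]
  refine ProbabilityTheory.differentiableOn_complexMGF.mono fun z hz => ?_
  exact interior_maximal (fun t => mem_integrableExpSet) isOpen_setOf_add_smul_mem_realRegion
    (complexLine_mem_H_iff.1 hz)

lemma frequently_nhdsNE_of_eventually_ofReal {P : ℂ → Prop} {a : ℝ} (h : ∀ᶠ t : ℝ in 𝓝 a, P t) :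
    ∃ᶠ z in 𝓝[≠] (a : ℂ), P z := by
  have tendsto_ofReal : Tendsto ((↑) : ℝ → ℂ) (𝓝[≠] a) (𝓝[≠] (a : ℂ)) :=
    Complex.continuous_ofReal.continuousAt.continuousWithinAt.tendsto_nhdsWithin
      fun _ => Complex.ofReal_injective.ne
  exact tendsto_ofReal.frequently (h.filter_mono nhdsWithin_le_nhds).frequently

/-- Restricted to the complex line through the real point `rePart s` in the direction of the
imaginary part of `s`, the identity is a one-variable identity that holds at all real points. -/
lemma zeta_mul_evalPow_eq {P Q : MvPolynomial (Var N) ℚ}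
    (h : ∀ σ : realRegion N, ((∫⁻ x, absIntegrand p σ.1 x ∂haar p N).toReal : ℂ) *
      evalPow p Q (fun v => σ.1 v) = evalPow p P (fun v => σ.1 v))
    {s : Var N → ℂ} (hs : s ∈ H N) : zeta p N s * evalPow p Q s = evalPow p P s := by
  set line : ℂ → Var N → ℂ := complexLine (rePart s) fun v => (s v).im
  have isOpen_U : IsOpen (line ⁻¹' H N) := isOpen_H.preimage differentiable_complexLine.continuous
  have analytic_evalPow (R : MvPolynomial (Var N) ℚ) :
      AnalyticOnNhd ℂ (fun z => evalPow p R (line z)) (line ⁻¹' H N) := fun z _ =>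
    (analyticAt_evalPow R _).comp (differentiable_complexLine.analyticAt z)
  have analytic_zeta : AnalyticOnNhd ℂ (fun z => zeta p N (line z)) (line ⁻¹' H N) :=
    (differentiableOn_zeta_complexLine _ _).analyticOnNhd isOpen_U
  have zero_mem : ((0 : ℝ) : ℂ) ∈ line ⁻¹' H N :=
    complexLine_mem_H_iff.2 (by simpa using rePart_mem_realRegion.2 hs)
  have I_mem : Complex.I ∈ line ⁻¹' H N := by
    simpa only [line, Set.mem_preimage, complexLine_I] using hs
  have eq_real : ∀ᶠ t : ℝ in 𝓝 0,
      zeta p N (line t) * evalPow p Q (line t) = evalPow p P (line t) := by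
    filter_upwards [isOpen_setOf_add_smul_mem_realRegion.mem_nhds
      (complexLine_mem_H_iff.1 zero_mem)] with t ht
    simpa only [line, complexLine_ofReal, zeta_ofReal] using h ⟨_, ht⟩
  simpa only [line, complexLine_I] using
    (analytic_zeta.mul (analytic_evalPow Q)).eqOn_of_preconnected_of_frequently_eq
      (analytic_evalPow P) convex_preimage_complexLine.isPreconnected zero_mem
      (frequently_nhdsNE_of_eventually_ofReal eq_real) I_mem

end Continuation

/-! ## Divergence -/

section Divergence

variable (p : ℕ) [hp : Fact p.Prime] {N : ℕ}

/-- The sides of a box of infinite measure whose points have coordinates of increasing absolute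
values, all greater than `1`. -/
def divergenceBox (N : ℕ) (i : T N) : Set ℚ_[p] :=
  if (i : ℕ) = N - 2 then (Metric.ball 0 ((p : ℝ) ^ (N - 2)))ᶜ
  else Metric.sphere 0 ((p : ℝ) ^ (i : ℕ))

lemma measurableSet_divergenceBox (i : T N) : MeasurableSet (divergenceBox p N i) := by
  unfold divergenceBox
  split_ifs
  exacts [Metric.isOpen_ball.measurableSet.compl, Metric.isClosed_sphere.measurableSet]

lemma padicHaar_compl_ball (a : ℚ_[p]) (r : ℝ) : padicHaar p (Metric.ball a r)ᶜ = ⊤ := by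
  have : NoncompactSpace ℚ_[p] := NormedSpace.noncompactSpace ℚ_[p] ℚ_[p]
  rw [measure_compl Metric.isOpen_ball.measurableSet Metric.isBounded_ball.measure_lt_top.ne,
    measure_univ_of_isAddLeftInvariant, ENNReal.top_sub Metric.isBounded_ball.measure_lt_top.ne]

lemma padicHaar_sphere_pow_ne_zero (n : ℕ) :
    padicHaar p (Metric.sphere 0 ((p : ℝ) ^ n)) ≠ 0 := by
  have p_pos : (0 : ℝ) < p := by exact_mod_cast hp.1.pos
  refine (IsOpen.measure_pos _ (IsUltrametricDist.isOpen_sphere _ (pow_pos p_pos n).ne')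
    ⟨((p : ℚ_[p]) ^ n)⁻¹, ?_⟩).ne'
  simp

lemma haar_pi_divergenceBox (hN : 4 ≤ N) : haar p N (Set.univ.pi (divergenceBox p N)) = ⊤ := by
  have last_mem : N - 2 ∈ Finset.Icc 2 (N - 2) := Finset.mem_Icc.2 ⟨by lia, le_rfl⟩
  have last_eq_top : padicHaar p (divergenceBox p N ⟨N - 2, last_mem⟩) = ⊤ := by
    rw [divergenceBox, if_pos rfl, padicHaar_compl_ball]
  rw [haar, Measure.pi_pi]
  refine WithTop.prod_eq_top (Finset.mem_univ _) last_eq_top fun i _ => ?_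
  unfold divergenceBox
  split_ifs
  · rw [padicHaar_compl_ball]
    exact ENNReal.top_ne_zero
  · exact padicHaar_sphere_pow_ne_zero p _

lemma pow_le_norm_of_mem_divergenceBox {x : T N → ℚ_[p]}
    (hx : x ∈ Set.univ.pi (divergenceBox p N)) (i : T N) : (p : ℝ) ^ (i : ℕ) ≤ ‖x i‖ := by
  have hxi := hx i (Set.mem_univ i)
  unfold divergenceBox at hxi
  split_ifs at hxi with hi
  · simpa [hi] using hxi
  · exact (mem_sphere_zero_iff_norm.1 hxi).ge

lemma norm_lt_norm_of_mem_divergenceBox {x : T N → ℚ_[p]}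
    (hx : x ∈ Set.univ.pi (divergenceBox p N)) {i j : T N} (hij : i < j) : ‖x i‖ < ‖x j‖ := by
  have hi : (i : ℕ) ≠ N - 2 :=
    (lt_of_lt_of_le (Subtype.coe_lt_coe.2 hij) (Finset.mem_Icc.1 j.2).2).ne
  have hxi : ‖x i‖ = (p : ℝ) ^ (i : ℕ) := by
    simpa [divergenceBox, hi] using hx i (Set.mem_univ i)
  calc ‖x i‖ = (p : ℝ) ^ (i : ℕ) := hxi
    _ < (p : ℝ) ^ (j : ℕ) := pow_lt_pow_right₀ (by exact_mod_cast hp.1.one_lt) hij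
    _ ≤ ‖x j‖ := pow_le_norm_of_mem_divergenceBox p hx j

lemma one_le_norm_factor_of_mem_divergenceBox {x : T N → ℚ_[p]}
    (hx : x ∈ Set.univ.pi (divergenceBox p N)) (v : Var N) : 1 ≤ ‖factor x v‖ := by
  have one_lt_norm (i : T N) : 1 < ‖x i‖ :=
    (one_lt_pow₀ (by exact_mod_cast hp.1.one_lt)
      (zero_lt_two.trans_le (Finset.mem_Icc.1 i.2).1).ne').trans_le
      (pow_le_norm_of_mem_divergenceBox p hx i)
  rcases v with i | i | e
  · exact (one_lt_norm i).le
  · rw [factor, sub_eq_add_neg, IsUltrametricDist.norm_add_eq_max_of_norm_ne_norm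
      (by simpa using (one_lt_norm i).ne), norm_one]
    exact le_max_left _ _
  · rw [factor, sub_eq_add_neg, IsUltrametricDist.norm_add_eq_max_of_norm_ne_norm
      (by simpa using (norm_lt_norm_of_mem_divergenceBox p hx e.2).ne)]
    exact (one_lt_norm _).le.trans (le_max_left _ _)

lemma lintegral_absIntegrand_eq_top (hN : 4 ≤ N) {σ : Var N → ℝ} (hσ : ∀ v, 0 ≤ σ v) :
    ∫⁻ x, absIntegrand p σ x ∂haar p N = ⊤ := by
  rw [eq_top_iff, ← haar_pi_divergenceBox p hN,
    ← lintegral_indicator_one (MeasurableSet.univ_pi (measurableSet_divergenceBox p))]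
  refine lintegral_mono fun x => Set.indicator_le (fun x hx => ?_) x
  exact Finset.one_le_prod' fun v _ =>
    one_le_normPow (hσ v) (one_le_norm_factor_of_mem_divergenceBox p hx v)

end Divergence

end StringZeta

theorem mainTheorem1 (p : ℕ) [Fact p.Prime] (N : ℕ) (hN : 4 ≤ N) :
    -- `H(ℂ)` is a non-empty open connected subset of `ℂ^D`
    (IsOpen (StringZeta.H N) ∧ IsConnected (StringZeta.H N)) ∧
    -- on it the integral converges absolutely and is a holomorphic function
    (∀ s ∈ StringZeta.H N,
      IntegrableOn (StringZeta.integrand p N s) (StringZeta.divisor p N)ᶜ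
        (StringZeta.haar p N)) ∧
    DifferentiableOn ℂ (StringZeta.zeta p N) (StringZeta.H N) ∧
    -- continuation to `ℂ^D` as a rational function of the `p^{-s_{ij}}`, and its poles
    (∃ P Q : MvPolynomial (StringZeta.Var N) ℚ, Q ≠ 0 ∧
      (∀ s ∈ StringZeta.H N, StringZeta.evalPow p Q s ≠ 0 ∧
        StringZeta.zeta p N s = StringZeta.evalPow p P s / StringZeta.evalPow p Q s) ∧
      (∀ s : StringZeta.Var N → ℂ, StringZeta.IsPole p P Q s →
        StringZeta.rePart s ∈ StringZeta.hyperplanes N)) ∧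
    -- divergence to `+∞` for non-negative real parts
    (∀ s : StringZeta.Var N → ℂ, (∀ v, 0 ≤ (s v).re) →
      ∫⁻ x in (StringZeta.divisor p N)ᶜ, ‖StringZeta.integrand p N s x‖ₑ
        ∂(StringZeta.haar p N) = ⊤) := by
  open StringZeta in
  obtain ⟨P, Q, hQ, hPQ⟩ := (lintegral_absIntegrand_mem_rationalFunctions (p := p) (N := N)).2
  have Q_ne_zero (s) (hs : s ∈ H N) : evalPow p Q s ≠ 0 := fun h =>
    rePart_notMem_hyperplanes hs (hQ s h)
  have zeta_eq (s) (hs : s ∈ H N) : zeta p N s = evalPow p P s / evalPow p Q s :=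
    (eq_div_iff (Q_ne_zero s hs)).2 (zeta_mul_evalPow_eq hPQ hs)
  have analyticAt_div (s) (hs : evalPow p Q s ≠ 0) :
      AnalyticAt ℂ (fun s => evalPow p P s / evalPow p Q s) s :=
    (analyticAt_evalPow P s).fun_div (analyticAt_evalPow Q s) hs
  refine ⟨⟨isOpen_H, H_nonempty, convex_H.isPreconnected⟩, fun s hs => integrableOn_integrand hs,
    fun s hs => ?_, ⟨P, Q, ?_, fun s hs => ⟨Q_ne_zero s hs, zeta_eq s hs⟩, fun s hs => ?_⟩,
    fun s hs => ?_⟩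
  · exact (analyticAt_div s (Q_ne_zero s hs)).differentiableAt.differentiableWithinAt.congr
      zeta_eq (zeta_eq s hs)
  · rintro rfl
    obtain ⟨s, hs⟩ := H_nonempty (N := N)
    exact Q_ne_zero s hs (by simp [evalPow])
  · by_contra hns
    exact hs ⟨_, analyticAt_div s (mt (hQ s) hns), Eventually.of_forall fun _ _ => rfl⟩
  · rw [lintegral_enorm_integrand]
    exact lintegral_absIntegrand_eq_top p hN hs
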